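/- A multihypergraph on a finite vertex set $V$ is a finite multiset of subsets of $V$ (its hyperedges). A $2$-cut of it is a partition of $V$ into two (possibly empty) parts; its size is the number of hyperedges, with multiplicity, meeting both parts; its surplus is its size minus the expected size of a uniformly random $2$-cut (each vertex is put into one of the two parts independently and uniformly). Let $\mathrm{surp}(H)$ be the maximum surplus of a $2$-cut of $H$. Let $k\in\mathbb{N}$ and let $C,c,p,D$ be real constants with $c,p>0$. For real $m,\Delta\ge 1$, a random multihypergraph $H=(V,R)$ is a random $(m,\Delta,k)$-multihypergraph of linear type (with implied constants $C,c,p,D$) if the following hold. (i) There is a multiset $X$ of at most $Cm$ subsets of $V$ of size at most $k$ ("potential hyperedges"), and $R$ is a random subset of $X$ determined as follows: there are a set $\mathcal{S}$, independent random variables $(Z_i)_{i\in\mathcal{S}}$ and, for every $e\in X$, a set $S_e\subseteq\mathcal{S}$ of size at most $k$ such that the event $e\in R$ is a function of $(Z_i)_{i\in S_e}$. (Different copies in $X$ of the same subset of $V$ may have different sets $S_e$.) (ii) $\mathbb{P}(e\in R,\,f\in R)\ge\mathbb{P}(e\in R)\,\mathbb{P}(f\in R)$ for all $e,f\in X$.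 (iii) There is $Y\subseteq X$ with $|Y|\ge cm$ such that $|e|\ge 2$ and $p\le\mathbb{P}(e\in R)\le 1-p$ for every $e\in Y$. (iv) Every vertex $u\in V$ lies in at most $\Delta$ potential hyperedges $e\in X$. (v) For any distinct $u,v\in V$ there are at most $D$ potential hyperedges $e\in X$ with $u,v\in e$; and for any $u\in V$ and $i\in\mathcal{S}$ there are at most $D$ potential hyperedges $e\in X$ with $u\in e$ and $i\in S_e$. Theorem. For all $k\in\mathbb{N}$ and real $C,c,p,D$ with $c,p>0$ there is a constant $c'=c'(k,C,c,p,D)>0$ such that, for all real $m,\Delta\ge 1$, every random $(m,\Delta,k)$-multihypergraph $H$ of linear type with implied constants $C,c,p,D$ satisfies $$\mathbb{E}[\mathrm{surp}(H)]\ \ge\ c'\,\frac{m}{\sqrt{\Delta}}.$$ -/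

import Mathlib

open MeasureTheory ProbabilityTheory

/-- A multihypergraph on the vertex set `V`: a finite multiset of hyperedges, each of them a
finite set of vertices. -/
abbrev Multihypergraph (V : Type*) := Multiset (Finset V)

namespace Multihypergraph

/-- The size of the `r`-cut `φ` (the partition of `V` into the classes `φ ⁻¹' {j}`): the number of
hyperedges, with multiplicity, that meet all `r` parts. -/
def cutSize {V : Type*} {r : ℕ} (H : Multihypergraph V) (φ : V → Fin r) : ℕ :=
  H.countP (fun e => ∀ j : Fin r, ∃ v ∈ e, φ v = j)

open scoped Classical in
/-- The expected size of a uniformly random `r`-cut, in which every vertex is put independently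
and uniformly into one of the `r` parts. -/
noncomputable def expectedCutSize {V : Type*} [Fintype V] (r : ℕ) (H : Multihypergraph V) : ℝ :=
  (∑ φ : V → Fin r, (H.cutSize φ : ℝ)) / (Fintype.card (V → Fin r) : ℝ)

/-- The `r`-surplus (for `r ≥ 1`): the maximum, over all `r`-cuts, of the size of the cut minus the
expected size of a uniformly random `r`-cut. -/
noncomputable def rSurplus {V : Type*} [Fintype V] (r : ℕ) (H : Multihypergraph V) : ℝ :=
  ⨆ φ : V → Fin r, ((H.cutSize φ : ℝ) - H.expectedCutSize r)

/-- The surplus is the `2`-surplus. -/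
noncomputable def surplus {V : Type*} [Fintype V] (H : Multihypergraph V) : ℝ :=
  H.rSurplus 2

end Multihypergraph

/-- Potential hyperedges on the vertex set `V`, indexed by `X` (so that a vertex set may occur
several times), each with a finite set of colours from `𝒮`. -/
structure ColouredHyperedges (V X 𝒮 : Type*) where
  verts : X → Finset V
  colours : X → Finset 𝒮

namespace ColouredHyperedges

/-- The multihypergraph formed by the potential hyperedges that belong to `R`. -/
def toMultihypergraph {V X 𝒮 : Type*} (G : ColouredHyperedges V X 𝒮) (R : Finset X) :
    Multihypergraph V :=
  R.val.map G.verts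

open scoped Classical in
/-- The random multihypergraph with vertex set `V` and random edge set `R`, a random subset of the
multiset of potential hyperedges `G`, is a random `(m, Δ, k)`-multihypergraph of linear type, as
witnessed by the colour variables `Z`. The implied constants of the definition are made explicit:
there are at most `C * m` potential hyperedges, at least `c * m` of them are in `Y`, the
probabilities of those in `Y` lie in `[p, 1 - p]`, and all codegrees are at most `D`. -/
structure IsLinearType {V X 𝒮 Ω : Type*} [Fintype X] [MeasurableSpace Ω]
    {β : 𝒮 → Type*} [∀ i, MeasurableSpace (β i)]
    (G : ColouredHyperedges V X 𝒮) (μ : Measure Ω) (Z : ∀ i, Ω → β i) (R : Ω → Finset X)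
    (m Δ : ℝ) (k : ℕ) (C c p D : ℝ) : Prop where
  card_verts_le : ∀ e, (G.verts e).card ≤ k
  card_le : (Fintype.card X : ℝ) ≤ C * m
  measurable_colour : ∀ i, Measurable (Z i)
  indep : iIndepFun Z μ
  card_colours_le : ∀ e, (G.colours e).card ≤ k
  /-- The event `e ∈ R` is a (measurable) function of the colour variables of `e`. -/
  determined : ∀ e, ∃ A : Set (∀ i : G.colours e, β i), MeasurableSet A ∧
    ∀ ω, e ∈ R ω ↔ (fun i : G.colours e => Z i ω) ∈ A
  correlation : ∀ e f,
    μ.real {ω | e ∈ R ω} * μ.real {ω | f ∈ R ω} ≤ μ.real {ω | e ∈ R ω ∧ f ∈ R ω}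
  gain : ∃ Y : Finset X, c * m ≤ (Y.card : ℝ) ∧
    ∀ e ∈ Y, 2 ≤ (G.verts e).card ∧
      p ≤ μ.real {ω | e ∈ R ω} ∧ μ.real {ω | e ∈ R ω} ≤ 1 - p
  degree_le : ∀ u : V, ((Finset.univ.filter fun e => u ∈ G.verts e).card : ℝ) ≤ Δ
  codegree_le : ∀ u v : V, u ≠ v →
    ((Finset.univ.filter fun e => u ∈ G.verts e ∧ v ∈ G.verts e).card : ℝ) ≤ D
  colour_codegree_le : ∀ (u : V) (i : 𝒮),
    ((Finset.univ.filter fun e => u ∈ G.verts e ∧ i ∈ G.colours e).card : ℝ) ≤ D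

end ColouredHyperedges

/-!
The surplus of a hypergraph is bounded below by the average surplus of a biased random `2`-cut, in
which the vertices choose their parts independently and the sign of the part of `v` has mean
`z v`. This average is a multilinear polynomial in `z` whose monomials are the nonempty
subsets `T` of hyperedges with `T.card` even, with negative coefficients
(`Multihypergraph.surplus_ge`).

The means `z` may depend on the random hypergraph and on auxiliary uniform signs `ε` of the
vertices. Fix a set `B` of vertices such that a positive proportion of the hyperedges `f` with
random presence have a vertex `b f` in `B` and a vertex `a f` outside `B`. Let `δ = θ / √Δ`, let
`ξ f` be `δ ε (a f)` times the centred indicator of `f`, and let `x u` be the sum of the `ξ f` with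
`b f = u`. Put `z v = ε v` outside `B`, and `z u = - τ sin (x u)` on `B`. Here `θ` and `τ` are small
constants. Only the fluctuations of the indicators enter `x u`, so that the nonrandom part of the
hypergraph cannot correlate the biases of different vertices.

* A monomial with exactly one vertex `u` in `B` gives a gain. By Stein's covariance identity for
  locally dependent variables (`norm_integral_mul_expSum_sub_le`) its correlation with `sin (x u)`
  is, up to `O(δ ^ 2)`, a positive multiple of its covariance with `x u`. The signs `ε` leave only
  covariances of indicators of hyperedges, which are nonnegative by assumption, and the variance
  of the hyperedge itself contributes order `δ`. The total gain is of order
  `τ θ m / √Δ`, with an error `O(τ θ ^ 2 m / √Δ)`.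
* A monomial with at least two vertices in `B` carries a factor `τ ^ 2`. It remains to see that
  the mean of a product of sines of block sums is `O(1 / √Δ)` on average. Such a product is a
  signed average of exponentials of signed sums of the `ξ f`. By Stein's identity each
  characteristic function nearly solves the differential equation of a Gaussian one
  (`norm_integral_expSum_sub_exp_le`), and the Gaussian terms would cancel if the block sums
  were uncorrelated (`abs_integral_prod_sin_le`). The correlations that are present are
  controlled by counting pairs of hyperedges with a common tail and a common colour
  (`sum_card_correlatedPairs_le`).

Choosing first `θ` and then `τ` small makes the gain dominate. The colours and the vertices are
treated alike: the auxiliary signs are added to the probability space, and all the variables are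
functions of the jointly independent colour variables and signs (`iIndep_jointColour`).
-/

/-! ### Biased random cuts -/

namespace Multihypergraph

/-- The two classes of a `2`-cut as signs. -/
def partSign (j : Fin 2) : ℝ := if j = 0 then 1 else -1

/-- The probability of the `2`-cut `φ` when the vertices choose their parts independently and
the sign of the part of `v` has mean `z v`. -/
noncomputable def biasedWeight {V : Type*} [Fintype V] (z : V → ℝ) (φ : V → Fin 2) : ℝ :=
  ∏ v, (1 + partSign (φ v) * z v) / 2

/-- Minus the coefficient of the monomial indexed by `T` in the multilinear polynomial that gives
the probability that a biased random `2`-cut cuts the hyperedge `e`. -/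
noncomputable def cutCoeff {V : Type*} (e T : Finset V) : ℝ :=
  (1 + (-1) ^ T.card) / 2 ^ e.card

lemma cutCoeff_nonneg {V : Type*} (e T : Finset V) : 0 ≤ cutCoeff e T := by
  unfold cutCoeff
  rcases neg_one_pow_eq_or ℝ T.card with h | h <;> rw [h] <;> (norm_num; try positivity)

lemma cutCoeff_of_odd {V : Type*} (e : Finset V) {T : Finset V} (hT : Odd T.card) :
    cutCoeff e T = 0 := by
  simp [cutCoeff, hT.neg_one_pow]

lemma cutCoeff_of_even {V : Type*} (e : Finset V) {T : Finset V} (hT : Even T.card) :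
    cutCoeff e T = 2 / 2 ^ e.card := by
  simp only [cutCoeff, hT.neg_one_pow]
  norm_num

lemma cutCoeff_le {V : Type*} (e T : Finset V) : cutCoeff e T ≤ 2 / 2 ^ e.card := by
  rcases Nat.even_or_odd T.card with h | h
  · rw [cutCoeff_of_even e h]
  · rw [cutCoeff_of_odd e h]; positivity

lemma sum_cutCoeff_le {V : Type*} (e : Finset V) : ∑ T ∈ e.powerset, cutCoeff e T ≤ 2 := by
  calc ∑ T ∈ e.powerset, cutCoeff e T ≤ ∑ _T ∈ e.powerset, 2 / (2 : ℝ) ^ e.card :=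
        Finset.sum_le_sum fun T _ => cutCoeff_le e T
    _ = 2 := by
        rw [Finset.sum_const, Finset.card_powerset, nsmul_eq_mul]
        push_cast
        field_simp

lemma cutSize_map {X : Type*} {r : ℕ} (g : X → Finset V) (s : Finset X) (φ : V → Fin r) :
    (cutSize (s.val.map g) φ : ℝ)
      = ∑ x ∈ s, if ∀ j, ∃ v ∈ g x, φ v = j then 1 else 0 := by
  classical
  rw [cutSize, Multiset.countP_map, Finset.sum_boole]
  rfl

section Biased

variable {V : Type*} [Fintype V]

lemma biasedWeight_nonneg {z : V → ℝ} (hz : ∀ v, |z v| ≤ 1) (φ : V → Fin 2) :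
    0 ≤ biasedWeight z φ := by
  refine Finset.prod_nonneg fun v _ => ?_
  have h := abs_le.1 (hz v)
  unfold partSign
  split_ifs <;> linarith [h.1, h.2]

open scoped Classical in
lemma sum_biasedWeight_monochromatic (z : V → ℝ) (e : Finset V) (j : Fin 2) :
    ∑ φ : V → Fin 2, biasedWeight z φ * (if ∀ v ∈ e, φ v = j then 1 else 0)
      = ∏ v ∈ e, (1 + partSign j * z v) / 2 := by
  have h1 : ∀ φ : V → Fin 2, biasedWeight z φ * (if ∀ v ∈ e, φ v = j then (1 : ℝ) else 0)
      = ∏ v, ((1 + partSign (φ v) * z v) / 2 * (if v ∈ e → φ v = j then 1 else 0)) := by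
    intro φ
    rw [Finset.prod_mul_distrib, biasedWeight, Finset.prod_ite_zero]
    simp
  simp_rw [h1]
  rw [← Fintype.prod_sum (κ := fun _ : V => Fin 2)
    (f := fun v x => (1 + partSign x * z v) / 2 * (if v ∈ e → x = j then (1 : ℝ) else 0))]
  rw [← Finset.prod_subset (Finset.subset_univ e)]
  · refine Finset.prod_congr rfl fun v hv => ?_
    simp [hv]
  · intro v _ hv
    simp [hv, Fin.sum_univ_two, partSign]
    ring

open scoped Classical in
lemma sum_biasedWeight (z : V → ℝ) : ∑ φ : V → Fin 2, biasedWeight z φ = 1 := by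
  simpa using sum_biasedWeight_monochromatic z ∅ 0

open scoped Classical in
lemma sum_biasedWeight_cut (z : V → ℝ) {e : Finset V} (he : e.Nonempty) :
    ∑ φ : V → Fin 2, biasedWeight z φ * (if ∀ j, ∃ v ∈ e, φ v = j then 1 else 0)
      = 1 - ∑ T ∈ e.powerset, cutCoeff e T * ∏ v ∈ T, z v := by
  have h1 : ∀ φ : V → Fin 2, (if ∀ j, ∃ v ∈ e, φ v = j then (1 : ℝ) else 0)
      = 1 - (if ∀ v ∈ e, φ v = 0 then 1 else 0) - (if ∀ v ∈ e, φ v = 1 then 1 else 0) := by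
    intro φ
    obtain ⟨u, hu⟩ := he
    have key : (∀ j, ∃ v ∈ e, φ v = j) ↔ ¬ (∀ v ∈ e, φ v = 0) ∧ ¬ (∀ v ∈ e, φ v = 1) := by
      rw [Fin.forall_fin_two]
      push Not
      have : ∀ x : Fin 2, x ≠ 0 ↔ x = 1 := by decide
      have h2 : ∀ x : Fin 2, x ≠ 1 ↔ x = 0 := by decide
      simp only [this, h2]
      exact and_comm
    by_cases h0 : ∀ v ∈ e, φ v = 0
    · have : ¬ ∀ v ∈ e, φ v = 1 := fun h => by
        have := (h0 u hu).symm.trans (h u hu); simp at this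
      rw [if_neg (fun h => (key.1 h).1 h0), if_pos h0, if_neg this]; norm_num
    · by_cases h1 : ∀ v ∈ e, φ v = 1
      · rw [if_neg (fun h => (key.1 h).2 h1), if_neg h0, if_pos h1]; norm_num
      · rw [if_pos (key.2 ⟨h0, h1⟩), if_neg h0, if_neg h1]; norm_num
  simp_rw [h1, mul_sub, mul_one, Finset.sum_sub_distrib]
  rw [sum_biasedWeight, sum_biasedWeight_monochromatic, sum_biasedWeight_monochromatic]
  have h2 : ∏ v ∈ e, (1 + partSign 0 * z v) / 2
      = ∑ T ∈ e.powerset, (∏ v ∈ T, z v) / 2 ^ e.card := by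
    rw [Finset.prod_div_distrib, Finset.prod_const, Finset.prod_one_add, Finset.sum_div]
    simp [partSign]
  have h3 : ∏ v ∈ e, (1 + partSign 1 * z v) / 2
      = ∑ T ∈ e.powerset, ((-1) ^ T.card * ∏ v ∈ T, z v) / 2 ^ e.card := by
    rw [Finset.prod_div_distrib, Finset.prod_const, Finset.prod_one_add, Finset.sum_div]
    refine Finset.sum_congr rfl fun T _ => ?_
    rw [Finset.prod_mul_distrib, Finset.prod_const]
    simp [partSign]
  rw [h2, h3, sub_sub, ← Finset.sum_add_distrib]
  congr 1
  refine Finset.sum_congr rfl fun T _ => ?_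
  unfold cutCoeff
  ring

open scoped Classical in
lemma sum_biasedWeight_cut_sub (z : V → ℝ) (e : Finset V) :
    ∑ φ : V → Fin 2, biasedWeight z φ * (if ∀ j, ∃ v ∈ e, φ v = j then 1 else 0)
      - ∑ φ : V → Fin 2, biasedWeight (fun _ => 0) φ * (if ∀ j, ∃ v ∈ e, φ v = j then 1 else 0)
      = - ∑ T ∈ e.powerset.erase ∅, cutCoeff e T * ∏ v ∈ T, z v := by
  rcases e.eq_empty_or_nonempty with rfl | he
  · simp
  · rw [sum_biasedWeight_cut z he, sum_biasedWeight_cut _ he,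
      ← Finset.add_sum_erase _ _ (Finset.empty_mem_powerset e),
      ← Finset.add_sum_erase _ (fun T => cutCoeff e T * ∏ v ∈ T, (0 : ℝ))
        (Finset.empty_mem_powerset e)]
    have : ∑ T ∈ e.powerset.erase ∅, cutCoeff e T * ∏ v ∈ T, (0 : ℝ) = 0 := by
      refine Finset.sum_eq_zero fun T hT => ?_
      rw [Finset.prod_const, zero_pow, mul_zero]
      rw [Finset.card_ne_zero, Finset.nonempty_iff_ne_empty]
      exact (Finset.mem_erase.1 hT).1
    rw [this]
    simp

open scoped Classical in
/-- A random `2`-cut with independent parts and mean signs `z` has average surplus equal to the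
right-hand side, so some `2`-cut has at least that surplus. -/
theorem surplus_ge {X : Type*} (g : X → Finset V) (s : Finset X) {z : V → ℝ}
    (hz : ∀ v, |z v| ≤ 1) :
    - ∑ x ∈ s, ∑ T ∈ (g x).powerset.erase ∅, cutCoeff (g x) T * ∏ v ∈ T, z v
      ≤ surplus (s.val.map g) := by
  classical
  set H : Multihypergraph V := s.val.map g with hH
  have h0 : ∀ φ : V → Fin 2, biasedWeight (fun _ => 0) φ
      = 1 / (Fintype.card (V → Fin 2) : ℝ) := by
    intro φ
    simp [biasedWeight]
  have hexp : H.expectedCutSize 2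
      = ∑ φ : V → Fin 2, biasedWeight (fun _ => 0) φ * (H.cutSize φ : ℝ) := by
    unfold expectedCutSize
    rw [Finset.sum_div]
    refine Finset.sum_congr (by congr!) fun φ _ => ?_
    rw [h0]
    simp only [Fintype.card_eq_nat_card]
    ring
  have hswap : ∀ y : V → ℝ, ∑ φ : V → Fin 2, biasedWeight y φ * (H.cutSize φ : ℝ)
      = ∑ x ∈ s, ∑ φ : V → Fin 2,
        biasedWeight y φ * (if ∀ j, ∃ v ∈ g x, φ v = j then 1 else 0) := by
    intro y
    rw [Finset.sum_comm]
    refine Finset.sum_congr rfl fun φ _ => ?_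
    rw [hH, cutSize_map, Finset.mul_sum]
  have hmain : - ∑ x ∈ s, ∑ T ∈ (g x).powerset.erase ∅, cutCoeff (g x) T * ∏ v ∈ T, z v
      = ∑ φ : V → Fin 2, biasedWeight z φ * ((H.cutSize φ : ℝ) - H.expectedCutSize 2) := by
    simp_rw [mul_sub]
    rw [Finset.sum_sub_distrib, ← Finset.sum_mul, sum_biasedWeight, one_mul, hexp, hswap, hswap,
      ← Finset.sum_sub_distrib, ← Finset.sum_neg_distrib]
    exact Finset.sum_congr rfl fun x _ => (sum_biasedWeight_cut_sub z (g x)).symm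
  rw [hmain]
  calc ∑ φ : V → Fin 2, biasedWeight z φ * ((H.cutSize φ : ℝ) - H.expectedCutSize 2)
      ≤ ∑ φ : V → Fin 2, biasedWeight z φ * H.surplus := by
        refine Finset.sum_le_sum fun φ _ => mul_le_mul_of_nonneg_left ?_ (biasedWeight_nonneg hz φ)
        exact le_ciSup (f := fun φ : V → Fin 2 => (H.cutSize φ : ℝ) - H.expectedCutSize 2)
          (Set.finite_range _).bddAbove φ
    _ = H.surplus := by rw [← Finset.sum_mul, sum_biasedWeight, one_mul]

end Biased

end Multihypergraph

/-! ### Stein's covariance identity under local dependence -/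

/-- The σ-algebra generated by the colour σ-algebras `m i` with `i ∈ S`. -/
abbrev colourSigma {I Ω : Type*} (m : I → MeasurableSpace Ω) (S : Set I) : MeasurableSpace Ω :=
  ⨆ i ∈ S, m i

lemma colourSigma_mono {I Ω : Type*} (m : I → MeasurableSpace Ω) {S T : Set I} (h : S ⊆ T) :
    colourSigma m S ≤ colourSigma m T :=
  biSup_mono h

lemma le_colourSigma {I Ω : Type*} (m : I → MeasurableSpace Ω) {S : Set I} {i : I} (h : i ∈ S) :
    m i ≤ colourSigma m S :=
  le_iSup₂_of_le i h le_rfl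

/-- The exponential `exp (i W)` of a finite sum `W` of random variables. -/
noncomputable def expSum {ι Ω : Type*} (ξ : ι → Ω → ℝ) (F : Finset ι) (ω : Ω) : ℂ :=
  Complex.exp (Complex.I * ((∑ g ∈ F, ξ g ω : ℝ) : ℂ))

lemma norm_exp_I_mul (x : ℝ) : ‖Complex.exp (Complex.I * (x : ℂ))‖ = 1 := by
  rw [mul_comm, Complex.norm_exp_ofReal_mul_I]

lemma norm_exp_I_mul_sub_le (x y : ℝ) :
    ‖Complex.exp (Complex.I * (x : ℂ)) - Complex.exp (Complex.I * (y : ℂ))‖ ≤ |x - y| := by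
  have h : Complex.exp (Complex.I * (x : ℂ)) - Complex.exp (Complex.I * (y : ℂ))
      = Complex.exp (Complex.I * (y : ℂ)) *
        (Complex.exp (Complex.I * ((x - y : ℝ) : ℂ)) - 1) := by
    rw [mul_sub, ← Complex.exp_add, mul_one]
    congr 2
    push_cast
    ring
  rw [h, norm_mul, norm_exp_I_mul, one_mul]
  exact Real.norm_exp_I_mul_ofReal_sub_one_le

lemma norm_exp_I_mul_sub_one_sub_le (x : ℝ) :
    ‖Complex.exp (Complex.I * (x : ℂ)) - 1 - Complex.I * x‖ ≤ x ^ 2 := by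
  have hd : ∀ t ∈ Set.Icc (0 : ℝ) 1, HasDerivWithinAt
      (fun t : ℝ => Complex.exp (Complex.I * x * t) - 1 - Complex.I * x * t)
      (Complex.I * x * (Complex.exp (Complex.I * ((x * t : ℝ) : ℂ)) - 1)) (Set.Icc 0 1) t := by
    intro t _
    have h1 : HasDerivAt (fun t : ℝ => Complex.I * x * (t : ℂ)) (Complex.I * x) t := by
      simpa using (Complex.ofRealCLM.hasDerivAt (x := t)).const_mul (Complex.I * (x : ℂ))
    refine HasDerivAt.hasDerivWithinAt ?_
    refine ((h1.cexp.sub_const 1).fun_sub h1).congr_deriv ?_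
    push_cast
    rw [mul_assoc Complex.I (x : ℂ) (t : ℂ)]
    ring
  have := norm_image_sub_le_of_norm_deriv_le_segment_01' hd (C := x ^ 2) ?_
  · simpa using this
  · intro t ht
    rw [norm_mul, norm_mul, Complex.norm_I, one_mul, Complex.norm_real, Real.norm_eq_abs]
    calc |x| * _ ≤ |x| * |x * t| := by
          gcongr
          exact Real.norm_exp_I_mul_ofReal_sub_one_le
      _ = x ^ 2 * |t| := by rw [abs_mul, ← mul_assoc, ← abs_mul, ← sq, abs_of_nonneg (sq_nonneg x)]
      _ ≤ x ^ 2 * 1 := by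
          gcongr
          rw [abs_of_nonneg ht.1]
          exact ht.2.le
      _ = x ^ 2 := mul_one _

section SumBounds

variable {ι Ω : Type*} {ξ : ι → Ω → ℝ} {δ : ℝ}

lemma norm_expSum (ξ : ι → Ω → ℝ) (F : Finset ι) (ω : Ω) : ‖expSum ξ F ω‖ = 1 :=
  norm_exp_I_mul _

lemma abs_sum_le_card_mul (hξ : ∀ g ω, |ξ g ω| ≤ δ) (F : Finset ι) (ω : Ω) :
    |∑ g ∈ F, ξ g ω| ≤ F.card * δ := by
  refine (Finset.abs_sum_le_sum_abs _ _).trans ?_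
  rw [← nsmul_eq_mul]
  exact Finset.sum_le_card_nsmul _ _ _ fun g _ => hξ g ω

lemma norm_expSum_sub_le [DecidableEq ι] (hξ : ∀ g ω, |ξ g ω| ≤ δ) {F F' : Finset ι} (h : F' ⊆ F)
    (ω : Ω) : ‖expSum ξ F ω - expSum ξ F' ω‖ ≤ (F \ F').card * δ := by
  refine (norm_exp_I_mul_sub_le _ _).trans ?_
  rw [← Finset.sum_sdiff h, add_sub_cancel_right]
  exact abs_sum_le_card_mul hξ _ ω

end SumBounds

section LocalDependence

variable {Ω I : Type*} {mΩ : MeasurableSpace Ω} {P : Measure Ω}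
  {m : I → MeasurableSpace Ω}

lemma colourSigma_le (hm : ∀ i, m i ≤ mΩ) (S : Set I) : colourSigma m S ≤ mΩ :=
  iSup₂_le fun i _ => hm i

lemma integral_mul_of_disjoint_colours {𝕜 : Type*} [RCLike 𝕜] [MeasurableSpace 𝕜] [BorelSpace 𝕜]
    (hm : ∀ i, m i ≤ mΩ) (hind : iIndep m P) {S T : Set I} (hST : Disjoint S T) {X Y : Ω → 𝕜}
    (hX : Measurable[colourSigma m S] X) (hY : Measurable[colourSigma m T] Y) :
    ∫ ω, X ω * Y ω ∂P = (∫ ω, X ω ∂P) * ∫ ω, Y ω ∂P := by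
  have h := indep_iSup_of_disjoint hm hind hST
  obtain rfl : ‹MeasurableSpace 𝕜› = RCLike.measurableSpace :=
    BorelSpace.measurable_eq.trans BorelSpace.measurable_eq.symm
  have hXY : X ⟂ᵢ[P] Y := by
    rw [IndepFun_iff_Indep]
    exact indep_of_indep_of_le_left (indep_of_indep_of_le_right h hY.comap_le) hX.comap_le
  exact hXY.integral_fun_mul_eq_mul_integral
    (hX.mono (colourSigma_le hm S) le_rfl).aestronglyMeasurable
    (hY.mono (colourSigma_le hm T) le_rfl).aestronglyMeasurable

variable [IsProbabilityMeasure P]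

lemma integrable_of_norm_le {E : Type*} [NormedAddCommGroup E] [MeasurableSpace E] [BorelSpace E]
    [SecondCountableTopology E] {f : Ω → E} (hf : Measurable f) {C : ℝ}
    (h : ∀ ω, ‖f ω‖ ≤ C) : Integrable f P :=
  Integrable.of_bound hf.aestronglyMeasurable C (ae_of_all _ h)

lemma norm_integral_le_of_forall_norm_le {E : Type*} [NormedAddCommGroup E] [NormedSpace ℝ E]
    {f : Ω → E} {C : ℝ} (h : ∀ ω, ‖f ω‖ ≤ C) : ‖∫ ω, f ω ∂P‖ ≤ C := by
  simpa using norm_integral_le_of_norm_le_const (μ := P) (ae_of_all _ h)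

variable {ι : Type*} {ξ : ι → Ω → ℝ} {c : ι → Set I} {δ : ℝ}

lemma measurable_expSum_colourSigma (hξm : ∀ g, Measurable[colourSigma m (c g)] (ξ g))
    {F : Finset ι} {S : Set I} (hS : ∀ g ∈ F, c g ⊆ S) :
    Measurable[colourSigma m S] (expSum ξ F) := by
  have h : Measurable[colourSigma m S] (fun ω => ∑ g ∈ F, ξ g ω) :=
    Finset.measurable_fun_sum F fun g hg => (hξm g).mono (colourSigma_mono m (hS g hg)) le_rfl
  exact Complex.measurable_exp.comp ((Complex.measurable_ofReal.comp h).const_mul Complex.I)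

lemma measurable_expSum (hm : ∀ i, m i ≤ mΩ) (hξm : ∀ g, Measurable[colourSigma m (c g)] (ξ g))
    (F : Finset ι) : Measurable (expSum ξ F) :=
  (measurable_expSum_colourSigma hξm (S := Set.univ) fun _ _ => Set.subset_univ _).mono
    (colourSigma_le hm _) le_rfl

open scoped Classical in
/-- The members of `F` that share a colour with `S`. -/
noncomputable def neighbours (c : ι → Set I) (F : Finset ι) (S : Set I) : Finset ι :=
  F.filter fun g => ¬ Disjoint (c g) S

/-- Stein's covariance identity under local dependence: if `Q` is centred and `W = ∑ ξ g`, then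
`E[Q exp (i W)]` is close to `i E[Q W] E[exp (i W)]`. One first removes from `W` the summands that
share a colour with `Q`, and then, for each of these, those that share a colour with it. -/
theorem norm_integral_mul_expSum_sub_le (hm : ∀ i, m i ≤ mΩ) (hind : iIndep m P)
    (hξm : ∀ g, Measurable[colourSigma m (c g)] (ξ g)) (hξ : ∀ g ω, |ξ g ω| ≤ δ)
    (F : Finset ι) {Q : Ω → ℝ} {cQ : Set I} (hQm : Measurable[colourSigma m cQ] Q) {q : ℝ}
    (hQ : ∀ ω, |Q ω| ≤ q) (hQ0 : ∫ ω, Q ω ∂P = 0) {M : ℝ}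
    (hNQ : ((neighbours c F cQ).card : ℝ) ≤ M)
    (hN : ∀ g ∈ F, ((neighbours c F (c g)).card : ℝ) ≤ M) :
    ‖∫ ω, (Q ω : ℂ) * expSum ξ F ω ∂P
        - Complex.I * ((∫ ω, Q ω * ∑ g ∈ F, ξ g ω ∂P : ℝ) : ℂ) * ∫ ω, expSum ξ F ω ∂P‖
      ≤ 4 * q * M ^ 2 * δ ^ 2 := by
  classical
  obtain ⟨ω₀⟩ : Nonempty Ω := P.nonempty_of_neZero
  have hq : 0 ≤ q := (abs_nonneg _).trans (hQ ω₀)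
  have hM : 0 ≤ M := (Nat.cast_nonneg _).trans hNQ
  have hQM : Measurable Q := hQm.mono (colourSigma_le hm _) le_rfl
  have hQmC : Measurable[colourSigma m cQ] fun ω => (Q ω : ℂ) :=
    Complex.measurable_ofReal.comp hQm
  have hQ0C : ∫ ω, (Q ω : ℂ) ∂P = 0 := by
    rw [integral_complex_ofReal, hQ0, Complex.ofReal_zero]
  have hξM : ∀ g, Measurable (ξ g) := fun g => (hξm g).mono (colourSigma_le hm _) le_rfl
  have hEM := fun F' => measurable_expSum hm hξm F'
  have hQC : ∀ ω, ‖(Q ω : ℂ)‖ ≤ q := fun ω => by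
    rw [Complex.norm_real]; exact hQ ω
  have hξC : ∀ g ω, ‖(ξ g ω : ℂ)‖ ≤ δ := fun g ω => by
    rw [Complex.norm_real]; exact hξ g ω
  set N := neighbours c F cQ with hNdef
  set F₀ := F.filter fun g => Disjoint (c g) cQ with hF₀
  have hF₀F : F₀ ⊆ F := Finset.filter_subset _ _
  have hsd : F \ F₀ = N := by
    ext g; simp only [hF₀, hNdef, neighbours, Finset.mem_sdiff, Finset.mem_filter]; tauto
  have hNF : N ⊆ F := Finset.filter_subset _ _
  rcases N.eq_empty_or_nonempty with hNe | ⟨g₀, hg₀⟩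
  · -- without neighbours, `Q` is independent of `W` and both terms vanish
    have hdis : ∀ g ∈ F, c g ⊆ cQᶜ := by
      intro g hg
      have : g ∉ N := by rw [hNe]; exact Finset.notMem_empty g
      simp only [hNdef, neighbours, Finset.mem_filter, not_and, not_not] at this
      exact Set.subset_compl_iff_disjoint_right.2 (this hg)
    have h1 : ∫ ω, (Q ω : ℂ) * expSum ξ F ω ∂P = 0 := by
      rw [integral_mul_of_disjoint_colours hm hind disjoint_compl_right
        hQmC (measurable_expSum_colourSigma hξm hdis), hQ0C, zero_mul]
    have h2 : ∫ ω, Q ω * ∑ g ∈ F, ξ g ω ∂P = 0 := by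
      rw [integral_mul_of_disjoint_colours hm hind (disjoint_compl_right (a := cQ)) hQm
        (Finset.measurable_fun_sum F fun g hg =>
          (hξm g).mono (colourSigma_mono m (hdis g hg)) le_rfl), hQ0, zero_mul]
    rw [h1, h2]
    simp only [Complex.ofReal_zero, mul_zero, zero_mul, sub_zero, norm_zero]
    positivity
  have hδ : 0 ≤ δ := (abs_nonneg _).trans (hξ g₀ ω₀)
  -- the first-order expansion of `exp (i W)` around the sum over `F₀`
  have hexp : ∀ ω, ‖expSum ξ F ω - expSum ξ F₀ ω
      - Complex.I * ((∑ g ∈ N, ξ g ω : ℝ) : ℂ) * expSum ξ F₀ ω‖ ≤ (M * δ) ^ 2 := by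
    intro ω
    have h1 : expSum ξ F ω
        = expSum ξ F₀ ω * Complex.exp (Complex.I * ((∑ g ∈ N, ξ g ω : ℝ) : ℂ)) := by
      unfold expSum
      rw [← Complex.exp_add, ← mul_add, ← Complex.ofReal_add, ← hsd, add_comm,
        Finset.sum_sdiff hF₀F]
    have h2 : expSum ξ F ω - expSum ξ F₀ ω
        - Complex.I * ((∑ g ∈ N, ξ g ω : ℝ) : ℂ) * expSum ξ F₀ ω
        = expSum ξ F₀ ω * (Complex.exp (Complex.I * ((∑ g ∈ N, ξ g ω : ℝ) : ℂ)) - 1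
          - Complex.I * ((∑ g ∈ N, ξ g ω : ℝ) : ℂ)) := by
      rw [h1]; ring
    rw [h2, norm_mul, norm_expSum, one_mul]
    refine (norm_exp_I_mul_sub_one_sub_le _).trans ?_
    rw [← sq_abs]
    have := abs_sum_le_card_mul hξ N ω
    gcongr
    exact this.trans (by gcongr)
  have hA : ‖∫ ω, (Q ω : ℂ) * (expSum ξ F ω - expSum ξ F₀ ω
      - Complex.I * ((∑ g ∈ N, ξ g ω : ℝ) : ℂ) * expSum ξ F₀ ω) ∂P‖ ≤ q * (M * δ) ^ 2 := by
    refine norm_integral_le_of_forall_norm_le fun ω => ?_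
    rw [norm_mul]
    exact mul_le_mul (hQC ω) (hexp ω) (norm_nonneg _) hq
  have hB : ∫ ω, (Q ω : ℂ) * expSum ξ F₀ ω ∂P = 0 := by
    rw [integral_mul_of_disjoint_colours hm hind (disjoint_compl_right (a := cQ))
      hQmC (measurable_expSum_colourSigma hξm fun g hg =>
        Set.subset_compl_iff_disjoint_right.2 (Finset.mem_filter.1 hg).2), hQ0C, zero_mul]
  have hintQ : ∀ F', Integrable (fun ω => (Q ω : ℂ) * expSum ξ F' ω) P := fun F' =>
    integrable_of_norm_le (C := q) (by have := hEM F'; fun_prop) fun ω => by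
      rw [norm_mul, norm_expSum, mul_one]; exact hQC ω
  have hintQξ : ∀ g F', Integrable (fun ω => (Q ω : ℂ) * (ξ g ω : ℂ) * expSum ξ F' ω) P :=
    fun g F' => integrable_of_norm_le (C := q * δ)
      (by have := hEM F'; have := hξM g; fun_prop) fun ω => by
        rw [norm_mul, norm_mul, norm_expSum, mul_one]
        exact mul_le_mul (hQC ω) (hξC g ω) (norm_nonneg _) hq
  have hintR : ∀ g, Integrable (fun ω => Q ω * ξ g ω) P :=
    fun g => integrable_of_norm_le (C := q * δ) (by have := hξM g; fun_prop) fun ω => by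
        rw [norm_mul]
        exact mul_le_mul (hQ ω) (hξ g ω) (norm_nonneg _) hq
  have hA' : ∫ ω, (Q ω : ℂ) * (expSum ξ F ω - expSum ξ F₀ ω
      - Complex.I * ((∑ g ∈ N, ξ g ω : ℝ) : ℂ) * expSum ξ F₀ ω) ∂P
      = ∫ ω, (Q ω : ℂ) * expSum ξ F ω ∂P
        - Complex.I * ∑ g ∈ N, ∫ ω, (Q ω : ℂ) * (ξ g ω : ℂ) * expSum ξ F₀ ω ∂P := by
    have h1 : ∀ ω, (Q ω : ℂ) * (expSum ξ F ω - expSum ξ F₀ ω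
      - Complex.I * ((∑ g ∈ N, ξ g ω : ℝ) : ℂ) * expSum ξ F₀ ω)
      = (Q ω : ℂ) * expSum ξ F ω - (Q ω : ℂ) * expSum ξ F₀ ω
        - Complex.I * ∑ g ∈ N, (Q ω : ℂ) * (ξ g ω : ℂ) * expSum ξ F₀ ω := by
      intro ω
      rw [← Finset.sum_mul, ← Finset.mul_sum]
      push_cast
      ring
    simp_rw [h1]
    have hs : Integrable (fun ω => ∑ g ∈ N, (Q ω : ℂ) * (ξ g ω : ℂ) * expSum ξ F₀ ω) P :=
      integrable_finsetSum N fun g _ => hintQξ g F₀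
    have hd : Integrable (fun ω => (Q ω : ℂ) * expSum ξ F ω - (Q ω : ℂ) * expSum ξ F₀ ω) P :=
      (hintQ F).sub (hintQ F₀)
    rw [integral_sub hd (hs.const_mul _),
      integral_sub (hintQ F) (hintQ F₀), hB, sub_zero, integral_const_mul,
      integral_finsetSum N fun g _ => hintQξ g F₀]
  have hcov : ∫ ω, Q ω * ∑ g ∈ F, ξ g ω ∂P = ∑ g ∈ N, ∫ ω, Q ω * ξ g ω ∂P := by
    simp_rw [Finset.mul_sum]
    rw [integral_finsetSum F fun g _ => hintR g]
    refine (Finset.sum_subset hNF fun g hg hgN => ?_).symm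
    have hd : Disjoint cQ (c g) := by
      simp only [hNdef, neighbours, Finset.mem_filter, not_and, not_not] at hgN
      exact (hgN hg).symm
    rw [integral_mul_of_disjoint_colours hm hind hd hQm (hξm g), hQ0, zero_mul]
  -- the sum over `F₁` is independent of `Q * ξ g`, and passing to it from `F₀` costs at most `M`
  -- summands
  have hterm : ∀ g ∈ N, ‖∫ ω, (Q ω : ℂ) * (ξ g ω : ℂ) * expSum ξ F₀ ω ∂P
      - ((∫ ω, Q ω * ξ g ω ∂P : ℝ) : ℂ) * ∫ ω, expSum ξ F ω ∂P‖ ≤ 3 * q * M * δ ^ 2 := by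
    intro g hg
    set F₁ := F.filter fun h => Disjoint (c h) (cQ ∪ c g) with hF₁
    have hF₁₀ : F₁ ⊆ F₀ := by
      intro h hh
      simp only [hF₁, hF₀, Finset.mem_filter, Set.disjoint_union_right] at hh ⊢
      exact ⟨hh.1, hh.2.1⟩
    have hc0 : ((F₀ \ F₁).card : ℝ) ≤ M := by
      refine le_trans ?_ (hN g (hNF hg))
      norm_cast
      refine Finset.card_le_card fun h hh => ?_
      simp only [hF₁, hF₀, neighbours, Finset.mem_filter, Set.disjoint_union_right,
        Finset.mem_sdiff] at hh ⊢
      tauto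
    have hc1 : ((F \ F₁).card : ℝ) ≤ 2 * M := by
      have : F \ F₁ ⊆ (F₀ \ F₁) ∪ N := by
        intro h hh
        simp only [← hsd, Finset.mem_sdiff, Finset.mem_union] at hh ⊢
        tauto
      have h2 := (Finset.card_le_card this).trans (Finset.card_union_le _ _)
      have h3 : ((F \ F₁).card : ℝ) ≤ ((F₀ \ F₁).card : ℝ) + N.card := by exact_mod_cast h2
      linarith
    have hind1 : ∫ ω, (Q ω : ℂ) * (ξ g ω : ℂ) * expSum ξ F₁ ω ∂P
        = ((∫ ω, Q ω * ξ g ω ∂P : ℝ) : ℂ) * ∫ ω, expSum ξ F₁ ω ∂P := by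
      have hQξ : Measurable[colourSigma m (cQ ∪ c g)] (fun ω => (Q ω : ℂ) * (ξ g ω : ℂ)) := by
        have h1 := hQm.mono (colourSigma_mono m (Set.subset_union_left (t := c g))) le_rfl
        have h2 := (hξm g).mono (colourSigma_mono m (Set.subset_union_right (s := cQ))) le_rfl
        fun_prop
      rw [integral_mul_of_disjoint_colours hm hind (disjoint_compl_right (a := cQ ∪ c g)) hQξ
        (measurable_expSum_colourSigma hξm fun h hh =>
          Set.subset_compl_iff_disjoint_right.2 (Finset.mem_filter.1 hh).2)]
      rw [← integral_complex_ofReal]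
      simp_rw [Complex.ofReal_mul]
      rfl
    have hsplit : ∫ ω, (Q ω : ℂ) * (ξ g ω : ℂ) * expSum ξ F₀ ω ∂P
        - ((∫ ω, Q ω * ξ g ω ∂P : ℝ) : ℂ) * ∫ ω, expSum ξ F ω ∂P
        = ∫ ω, (Q ω : ℂ) * (ξ g ω : ℂ) * (expSum ξ F₀ ω - expSum ξ F₁ ω) ∂P
          - ((∫ ω, Q ω * ξ g ω ∂P : ℝ) : ℂ) * ∫ ω, (expSum ξ F ω - expSum ξ F₁ ω) ∂P := by
      have hiE : ∀ F', Integrable (expSum ξ F') P := fun F' =>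
        integrable_of_norm_le (hEM F') fun ω => (norm_expSum ξ F' ω).le
      simp_rw [mul_sub]
      rw [integral_sub (hintQξ g F₀) (hintQξ g F₁), integral_sub (hiE F) (hiE F₁), hind1]
      ring
    rw [hsplit]
    have hb1 : ‖∫ ω, (Q ω : ℂ) * (ξ g ω : ℂ) * (expSum ξ F₀ ω - expSum ξ F₁ ω) ∂P‖
        ≤ q * δ * (M * δ) := by
      refine norm_integral_le_of_forall_norm_le fun ω => ?_
      rw [norm_mul, norm_mul]
      have h1 := (norm_expSum_sub_le hξ hF₁₀ ω).trans (mul_le_mul_of_nonneg_right hc0 hδ)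
      exact mul_le_mul (mul_le_mul (hQC ω) (hξC g ω) (norm_nonneg _) hq) h1 (norm_nonneg _)
        (by positivity)
    have hb2 : ‖((∫ ω, Q ω * ξ g ω ∂P : ℝ) : ℂ) * ∫ ω, (expSum ξ F ω - expSum ξ F₁ ω) ∂P‖
        ≤ q * δ * (2 * M * δ) := by
      rw [norm_mul, Complex.norm_real]
      refine mul_le_mul ?_ ?_ (norm_nonneg _) (by positivity)
      · refine norm_integral_le_of_forall_norm_le fun ω => ?_
        rw [norm_mul]
        exact mul_le_mul (hQ ω) (hξ g ω) (norm_nonneg _) hq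
      · exact norm_integral_le_of_forall_norm_le fun ω =>
          (norm_expSum_sub_le hξ (hF₁₀.trans hF₀F) ω).trans (mul_le_mul_of_nonneg_right hc1 hδ)
    calc _ ≤ q * δ * (M * δ) + q * δ * (2 * M * δ) := (norm_sub_le _ _).trans (add_le_add hb1 hb2)
      _ = 3 * q * M * δ ^ 2 := by ring
  have hfinal : ∫ ω, (Q ω : ℂ) * expSum ξ F ω ∂P
        - Complex.I * ((∫ ω, Q ω * ∑ g ∈ F, ξ g ω ∂P : ℝ) : ℂ) * ∫ ω, expSum ξ F ω ∂P
      = (∫ ω, (Q ω : ℂ) * (expSum ξ F ω - expSum ξ F₀ ω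
          - Complex.I * ((∑ g ∈ N, ξ g ω : ℝ) : ℂ) * expSum ξ F₀ ω) ∂P)
        + Complex.I * ∑ g ∈ N, (∫ ω, (Q ω : ℂ) * (ξ g ω : ℂ) * expSum ξ F₀ ω ∂P
          - ((∫ ω, Q ω * ξ g ω ∂P : ℝ) : ℂ) * ∫ ω, expSum ξ F ω ∂P) := by
    rw [hA', hcov, Finset.sum_sub_distrib, ← Finset.sum_mul]
    push_cast
    ring
  rw [hfinal]
  have hsum : ‖∑ g ∈ N, (∫ ω, (Q ω : ℂ) * (ξ g ω : ℂ) * expSum ξ F₀ ω ∂P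
          - ((∫ ω, Q ω * ξ g ω ∂P : ℝ) : ℂ) * ∫ ω, expSum ξ F ω ∂P)‖
        ≤ M * (3 * q * M * δ ^ 2) := by
    refine (norm_sum_le_of_le N hterm).trans ?_
    rw [Finset.sum_const, nsmul_eq_mul]
    gcongr
  calc _ ≤ q * (M * δ) ^ 2 + M * (3 * q * M * δ ^ 2) := by
        refine (norm_add_le _ _).trans (add_le_add hA ?_)
        rw [norm_mul, Complex.norm_I, one_mul]
        exact hsum
    _ = 4 * q * M ^ 2 * δ ^ 2 := by ring

end LocalDependence

/-! ### Characteristic functions under local dependence -/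

section CharacteristicFunction

variable {Ω I : Type*} {mΩ : MeasurableSpace Ω} {P : Measure Ω} [IsProbabilityMeasure P]
  {m : I → MeasurableSpace Ω} {ι : Type*} {ξ : ι → Ω → ℝ} {c : ι → Set I} {δ : ℝ}

lemma hasDerivAt_integral_exp_I_mul {W : Ω → ℝ} (hW : Measurable W) {B : ℝ}
    (hB : ∀ ω, |W ω| ≤ B) (s : ℝ) :
    HasDerivAt (fun s : ℝ => ∫ ω, Complex.exp (Complex.I * ((s * W ω : ℝ) : ℂ)) ∂P)
      (Complex.I * ∫ ω, (W ω : ℂ) * Complex.exp (Complex.I * ((s * W ω : ℝ) : ℂ)) ∂P) s := by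
  rw [← integral_const_mul]
  refine (hasDerivAt_integral_of_dominated_loc_of_deriv_le (μ := P) (𝕜 := ℝ) (bound := fun _ => B)
    (F := fun (s : ℝ) ω => Complex.exp (Complex.I * ((s * W ω : ℝ) : ℂ)))
    (F' := fun (s : ℝ) ω =>
      Complex.I * ((W ω : ℂ) * Complex.exp (Complex.I * ((s * W ω : ℝ) : ℂ))))
    (s := Set.univ) Filter.univ_mem (Filter.Eventually.of_forall fun s => ?_) ?_ ?_
    (ae_of_all _ fun ω s _ => ?_) (integrable_const B) (ae_of_all _ fun ω s _ => ?_)).2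
  · exact (by fun_prop : Measurable _).aestronglyMeasurable
  · exact integrable_of_norm_le (C := 1) (by fun_prop) fun ω => (norm_exp_I_mul _).le
  · exact (by fun_prop : Measurable _).aestronglyMeasurable
  · rw [norm_mul, norm_mul, norm_exp_I_mul, Complex.norm_I, one_mul, mul_one, Complex.norm_real]
    exact hB ω
  · have h1 : HasDerivAt (fun s : ℝ => Complex.I * ((s * W ω : ℝ) : ℂ))
        (Complex.I * ((W ω : ℝ) : ℂ)) s := by
      have := (((hasDerivAt_id s).mul_const (W ω)).ofReal_comp).const_mul Complex.I
      simpa using this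
    refine h1.cexp.congr_deriv ?_
    ring

/-- Under local dependence the characteristic function of a sum of centred bounded variables is
close to that of a centred Gaussian variable of the same variance: by Stein's covariance identity
`s ↦ E[exp (i s W)]` almost solves the differential equation `φ' = - s Var(W) φ`. -/
theorem norm_integral_expSum_sub_exp_le (hm : ∀ i, m i ≤ mΩ) (hind : iIndep m P)
    (hξm : ∀ g, Measurable[colourSigma m (c g)] (ξ g)) (hξ : ∀ g ω, |ξ g ω| ≤ δ) (hδ : 0 ≤ δ)
    (hξ0 : ∀ g, ∫ ω, ξ g ω ∂P = 0) (F : Finset ι) {M : ℝ}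
    (hN : ∀ g ∈ F, ((neighbours c F (c g)).card : ℝ) ≤ M) :
    ‖∫ ω, expSum ξ F ω ∂P - (Real.exp (-(∫ ω, (∑ g ∈ F, ξ g ω) ^ 2 ∂P) / 2) : ℂ)‖
      ≤ 4 * F.card * M ^ 2 * δ ^ 3 := by
  set W : Ω → ℝ := fun ω => ∑ g ∈ F, ξ g ω with hWdef
  set v : ℝ := ∫ ω, W ω ^ 2 ∂P with hv
  set K : ℝ := 4 * F.card * M ^ 2 * δ ^ 3 with hK
  have hK0 : 0 ≤ K := by positivity
  have hv0 : 0 ≤ v := integral_nonneg fun ω => sq_nonneg _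
  have hξM : ∀ g, Measurable (ξ g) := fun g => (hξm g).mono (colourSigma_le hm _) le_rfl
  have hWM : Measurable W := Finset.measurable_fun_sum F fun g _ => hξM g
  have hWB : ∀ ω, |W ω| ≤ F.card * δ := fun ω => abs_sum_le_card_mul hξ F ω
  set φ : ℝ → ℂ := fun s => ∫ ω, Complex.exp (Complex.I * ((s * W ω : ℝ) : ℂ)) ∂P with hφ
  have key : ∀ s ∈ Set.Icc (0 : ℝ) 1,
      ‖∫ ω, (W ω : ℂ) * Complex.exp (Complex.I * ((s * W ω : ℝ) : ℂ)) ∂P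
        - Complex.I * ((s * v : ℝ) : ℂ) * φ s‖ ≤ K := by
    intro s hs
    have hexp : ∀ ω, expSum (fun g ω => s * ξ g ω) F ω
        = Complex.exp (Complex.I * ((s * W ω : ℝ) : ℂ)) := by
      intro ω
      simp only [expSum, hWdef, Finset.mul_sum]
    have hterm : ∀ f ∈ F, ‖∫ ω, (ξ f ω : ℂ) * Complex.exp (Complex.I * ((s * W ω : ℝ) : ℂ)) ∂P
        - Complex.I * ((s * ∫ ω, ξ f ω * W ω ∂P : ℝ) : ℂ) * φ s‖ ≤ 4 * M ^ 2 * δ ^ 3 := by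
      intro f hf
      have h := norm_integral_mul_expSum_sub_le (ξ := fun g ω => s * ξ g ω) (c := c) (δ := δ)
        hm hind (fun g => (hξm g).const_mul s) (fun g ω => by
          rw [abs_mul, abs_of_nonneg hs.1]
          exact (mul_le_of_le_one_left (abs_nonneg _) hs.2).trans (hξ g ω)) F (hξm f) (hξ f)
        (hξ0 f) (hN f hf) hN
      simp_rw [hexp, ← Finset.mul_sum, mul_left_comm _ s] at h
      rw [integral_const_mul] at h
      refine h.trans (le_of_eq (by ring))
    have hsum1 : ∫ ω, (W ω : ℂ) * Complex.exp (Complex.I * ((s * W ω : ℝ) : ℂ)) ∂P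
        = ∑ f ∈ F, ∫ ω, (ξ f ω : ℂ) * Complex.exp (Complex.I * ((s * W ω : ℝ) : ℂ)) ∂P := by
      rw [← integral_finsetSum]
      · refine integral_congr_ae (ae_of_all _ fun ω => ?_)
        simp only [hWdef, ← Finset.sum_mul, Complex.ofReal_sum]
      · intro f _
        refine integrable_of_norm_le (C := δ) (by have := hξM f; fun_prop) fun ω => ?_
        rw [norm_mul, norm_exp_I_mul, mul_one, Complex.norm_real]
        exact hξ f ω
    have hsum2 : v = ∑ f ∈ F, ∫ ω, ξ f ω * W ω ∂P := by
      rw [← integral_finsetSum]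
      · refine integral_congr_ae (ae_of_all _ fun ω => ?_)
        simp only [← Finset.sum_mul, sq, hWdef]
      · intro f _
        refine integrable_of_norm_le (C := δ * (F.card * δ))
          (by have := hξM f; fun_prop) fun ω => ?_
        rw [norm_mul]
        exact mul_le_mul (hξ f ω) (hWB ω) (norm_nonneg _) hδ
    have hdec : ∫ ω, (W ω : ℂ) * Complex.exp (Complex.I * ((s * W ω : ℝ) : ℂ)) ∂P
        - Complex.I * ((s * v : ℝ) : ℂ) * φ s
        = ∑ f ∈ F, (∫ ω, (ξ f ω : ℂ) * Complex.exp (Complex.I * ((s * W ω : ℝ) : ℂ)) ∂P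
          - Complex.I * ((s * ∫ ω, ξ f ω * W ω ∂P : ℝ) : ℂ) * φ s) := by
      rw [Finset.sum_sub_distrib, ← hsum1, ← Finset.sum_mul, ← Finset.mul_sum,
        ← Complex.ofReal_sum, ← Finset.mul_sum, ← hsum2]
    rw [hdec]
    refine (norm_sum_le_of_le F hterm).trans (le_of_eq ?_)
    rw [Finset.sum_const, nsmul_eq_mul, hK]
    ring
  -- multiply by the integrating factor of the equation `φ' = - s v φ`
  have hderiv : ∀ s : ℝ, HasDerivAt (fun s : ℝ => φ s * Complex.exp ((s ^ 2 * (v / 2) : ℝ) : ℂ))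
      (Complex.I * (∫ ω, (W ω : ℂ) * Complex.exp (Complex.I * ((s * W ω : ℝ) : ℂ)) ∂P
        - Complex.I * ((s * v : ℝ) : ℂ) * φ s) * Complex.exp ((s ^ 2 * (v / 2) : ℝ) : ℂ)) s := by
    intro s
    have h1 := hasDerivAt_integral_exp_I_mul (P := P) hWM hWB s
    have h2 : HasDerivAt (fun s : ℝ => ((s ^ 2 * (v / 2) : ℝ) : ℂ)) ((s * v : ℝ) : ℂ) s := by
      refine (((hasDerivAt_pow 2 s).mul_const (v / 2)).ofReal_comp).congr_deriv ?_
      push_cast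
      ring
    refine (h1.mul h2.cexp).congr_deriv ?_
    rw [mul_sub, ← mul_assoc Complex.I, ← mul_assoc Complex.I, Complex.I_mul_I]
    ring
  have hmv := norm_image_sub_le_of_norm_deriv_le_segment_01' (C := K * Real.exp (v / 2))
    (fun s _ => (hderiv s).hasDerivWithinAt) (fun s hs => by
      rw [norm_mul, norm_mul, Complex.norm_I, one_mul, Complex.norm_exp, Complex.ofReal_re]
      refine mul_le_mul (key s ⟨hs.1, hs.2.le⟩) (Real.exp_le_exp.2 ?_) (Real.exp_nonneg _) hK0
      have : s ^ 2 ≤ 1 := pow_le_one₀ hs.1 hs.2.le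
      nlinarith)
  have hφ0 : φ 0 = 1 := by simp [hφ]
  have hφ1 : φ 1 = ∫ ω, expSum ξ F ω ∂P := by
    simp [hφ, expSum, hWdef]
  have hrw : ∫ ω, expSum ξ F ω ∂P - (Real.exp (-v / 2) : ℂ)
      = (Real.exp (-v / 2) : ℂ) * (φ 1 * Complex.exp (((1 : ℝ) ^ 2 * (v / 2) : ℝ) : ℂ)
        - φ 0 * Complex.exp (((0 : ℝ) ^ 2 * (v / 2) : ℝ) : ℂ)) := by
    rw [hφ0, hφ1, mul_sub, mul_left_comm, Complex.ofReal_exp, ← Complex.exp_add]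
    simp only [one_pow, one_mul]
    rw [← Complex.ofReal_add, neg_div, neg_add_cancel]
    simp
  rw [hrw, norm_mul, Complex.norm_real, Real.norm_eq_abs, Real.abs_exp]
  calc _ ≤ Real.exp (-v / 2) * (K * Real.exp (v / 2)) := by gcongr
    _ = K := by
      rw [mul_left_comm, ← Real.exp_add, neg_div, neg_add_cancel, Real.exp_zero, mul_one]

lemma abs_integral_mul_sum_le (hm : ∀ i, m i ≤ mΩ) (hind : iIndep m P)
    (hξm : ∀ g, Measurable[colourSigma m (c g)] (ξ g)) (hξ : ∀ g ω, |ξ g ω| ≤ δ) (hδ : 0 ≤ δ)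
    (F : Finset ι) {Q : Ω → ℝ} {cQ : Set I} (hQm : Measurable[colourSigma m cQ] Q) {q : ℝ}
    (hq : 0 ≤ q) (hQ : ∀ ω, |Q ω| ≤ q) (hQ0 : ∫ ω, Q ω ∂P = 0) {M : ℝ}
    (hNQ : ((neighbours c F cQ).card : ℝ) ≤ M) :
    |∫ ω, Q ω * ∑ g ∈ F, ξ g ω ∂P| ≤ M * q * δ := by
  classical
  have hξM : ∀ g, Measurable (ξ g) := fun g => (hξm g).mono (colourSigma_le hm _) le_rfl
  have hQM : Measurable Q := hQm.mono (colourSigma_le hm _) le_rfl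
  have hb : ∀ g ω, ‖Q ω * ξ g ω‖ ≤ q * δ := fun g ω => by
    rw [norm_mul]
    exact mul_le_mul (hQ ω) (hξ g ω) (norm_nonneg _) hq
  have hcov : ∫ ω, Q ω * ∑ g ∈ F, ξ g ω ∂P = ∑ g ∈ neighbours c F cQ, ∫ ω, Q ω * ξ g ω ∂P := by
    simp_rw [Finset.mul_sum]
    rw [integral_finsetSum F fun g _ => integrable_of_norm_le
      (by have := hξM g; fun_prop) (hb g)]
    refine (Finset.sum_subset (Finset.filter_subset _ _) fun g hg hgN => ?_).symm
    have hd : Disjoint cQ (c g) := by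
      simp only [Finset.mem_filter, not_and, not_not] at hgN
      exact (hgN hg).symm
    rw [integral_mul_of_disjoint_colours hm hind hd hQm (hξm g), hQ0, zero_mul]
  rw [hcov, ← Real.norm_eq_abs]
  refine (norm_sum_le_of_le _ fun g _ => norm_integral_le_of_forall_norm_le (hb g)).trans ?_
  rw [Finset.sum_const, nsmul_eq_mul, mul_assoc]
  gcongr

lemma integral_sum_sq_le (hm : ∀ i, m i ≤ mΩ) (hind : iIndep m P)
    (hξm : ∀ g, Measurable[colourSigma m (c g)] (ξ g)) (hξ : ∀ g ω, |ξ g ω| ≤ δ) (hδ : 0 ≤ δ)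
    (hξ0 : ∀ g, ∫ ω, ξ g ω ∂P = 0) (F : Finset ι) {M : ℝ}
    (hN : ∀ g ∈ F, ((neighbours c F (c g)).card : ℝ) ≤ M) :
    ∫ ω, (∑ g ∈ F, ξ g ω) ^ 2 ∂P ≤ F.card * M * δ ^ 2 := by
  have hξM : ∀ g, Measurable (ξ g) := fun g => (hξm g).mono (colourSigma_le hm _) le_rfl
  have h1 : ∫ ω, (∑ g ∈ F, ξ g ω) ^ 2 ∂P = ∑ f ∈ F, ∫ ω, ξ f ω * ∑ g ∈ F, ξ g ω ∂P := by
    rw [← integral_finsetSum]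
    · simp only [← Finset.sum_mul, sq]
    · intro f _
      refine integrable_of_norm_le (C := δ * (F.card * δ))
        ((hξM f).mul (Finset.measurable_fun_sum F fun g _ => hξM g)) fun ω => ?_
      rw [norm_mul]
      exact mul_le_mul (hξ f ω) (abs_sum_le_card_mul hξ F ω) (norm_nonneg _) hδ
  rw [h1]
  refine (Finset.sum_le_sum fun f hf => (le_abs_self _).trans
    (abs_integral_mul_sum_le hm hind hξm hξ hδ F (hξm f) hδ (hξ f) (hξ0 f) (hN f hf))).trans ?_
  rw [Finset.sum_const, nsmul_eq_mul]
  exact le_of_eq (by ring)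

/-- The imaginary part of Stein's covariance identity, once the variance of `W` is at most `1`. -/
lemma half_integral_mul_sum_sub_le (hm : ∀ i, m i ≤ mΩ) (hind : iIndep m P)
    (hξm : ∀ g, Measurable[colourSigma m (c g)] (ξ g)) (hξ : ∀ g ω, |ξ g ω| ≤ δ)
    (F : Finset ι) {Q : Ω → ℝ} {cQ : Set I} (hQm : Measurable[colourSigma m cQ] Q)
    (hQ : ∀ ω, |Q ω| ≤ 1) (hQ0 : ∫ ω, Q ω ∂P = 0) {M : ℝ}
    (hNQ : ((neighbours c F cQ).card : ℝ) ≤ M)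
    (hN : ∀ g ∈ F, ((neighbours c F (c g)).card : ℝ) ≤ M)
    (hpos : 0 ≤ ∫ ω, Q ω * ∑ g ∈ F, ξ g ω ∂P)
    (hvar : ∫ ω, (∑ g ∈ F, ξ g ω) ^ 2 ∂P ≤ 1) :
    (∫ ω, Q ω * ∑ g ∈ F, ξ g ω ∂P) / 2 - 4 * M ^ 2 * δ ^ 2
      ≤ ∫ ω, Q ω * Real.sin (∑ g ∈ F, ξ g ω) ∂P := by
  have hξM : ∀ g, Measurable (ξ g) := fun g => (hξm g).mono (colourSigma_le hm _) le_rfl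
  have hQM : Measurable Q := hQm.mono (colourSigma_le hm _) le_rfl
  have hWM : Measurable fun ω => ∑ g ∈ F, ξ g ω := Finset.measurable_fun_sum F fun g _ => hξM g
  have hEM := measurable_expSum hm hξm F
  have h := norm_integral_mul_expSum_sub_le hm hind hξm hξ F hQm hQ hQ0 hNQ hN
  set a := ∫ ω, Q ω * ∑ g ∈ F, ξ g ω ∂P with ha
  have hre : (∫ ω, expSum ξ F ω ∂P).re = ∫ ω, Real.cos (∑ g ∈ F, ξ g ω) ∂P := by
    have hi : Integrable (expSum ξ F) P :=
      integrable_of_norm_le hEM fun ω => (norm_expSum ξ F ω).le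
    refine ((integral_re hi).symm).trans (integral_congr_ae (ae_of_all _ fun ω => ?_))
    simp only [expSum]
    rw [mul_comm]
    exact Complex.exp_ofReal_mul_I_re _
  have him : (∫ ω, (Q ω : ℂ) * expSum ξ F ω ∂P).im
      = ∫ ω, Q ω * Real.sin (∑ g ∈ F, ξ g ω) ∂P := by
    have hi : Integrable (fun ω => (Q ω : ℂ) * expSum ξ F ω) P :=
      integrable_of_norm_le (C := 1) (by fun_prop) fun ω => by
        rw [norm_mul, norm_expSum, mul_one, Complex.norm_real]; exact hQ ω
    refine ((integral_im hi).symm).trans (integral_congr_ae (ae_of_all _ fun ω => ?_))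
    change ((Q ω : ℂ) * expSum ξ F ω).im = _
    rw [Complex.im_ofReal_mul, expSum, mul_comm Complex.I, Complex.exp_ofReal_mul_I_im]
  have hcos : 1 / 2 ≤ ∫ ω, Real.cos (∑ g ∈ F, ξ g ω) ∂P := by
    have hb : ∀ ω, ‖1 - (∑ g ∈ F, ξ g ω) ^ 2 / 2‖ ≤ 1 + (F.card * δ) ^ 2 / 2 := by
      intro ω
      have h1 := abs_sum_le_card_mul hξ F ω
      have h2 : (∑ g ∈ F, ξ g ω) ^ 2 ≤ (F.card * δ) ^ 2 := by
        rw [← sq_abs]; gcongr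
      rw [Real.norm_eq_abs, abs_le]
      constructor <;> nlinarith [sq_nonneg (∑ g ∈ F, ξ g ω)]
    have hb' : ∀ ω, ‖(∑ g ∈ F, ξ g ω) ^ 2‖ ≤ (F.card * δ) ^ 2 := by
      intro ω
      rw [Real.norm_eq_abs, abs_pow]
      have h1 := abs_sum_le_card_mul hξ F ω
      gcongr
    have h2 : ∫ ω, (1 - (∑ g ∈ F, ξ g ω) ^ 2 / 2) ∂P ≤ ∫ ω, Real.cos (∑ g ∈ F, ξ g ω) ∂P := by
      refine integral_mono (integrable_of_norm_le (by fun_prop) hb)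
        (integrable_of_norm_le (C := 1) (by fun_prop) fun ω => Real.abs_cos_le_one _) fun ω => ?_
      exact Real.one_sub_sq_div_two_le_cos
    rw [integral_sub (integrable_const _)
      ((integrable_of_norm_le (by fun_prop) hb').div_const 2), integral_div] at h2
    simp only [integral_const, probReal_univ, smul_eq_mul, mul_one] at h2
    linarith
  have h1 := (Complex.abs_im_le_norm _).trans h
  rw [Complex.sub_im, him, mul_assoc, Complex.I_mul_im, Complex.re_ofReal_mul, hre] at h1
  have h2 := (abs_le.1 h1).1
  have h3 : a / 2 ≤ a * ∫ ω, Real.cos (∑ g ∈ F, ξ g ω) ∂P := by nlinarith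
  linarith

end CharacteristicFunction

/-! ### Products of sines of block sums -/

section ProductsOfSines

variable {V ι Ω : Type*} [DecidableEq V]

/-- The sum of the variables `ξ f` with `f ∈ F` that are assigned to the vertex `v`. -/
noncomputable def blockSum (ξ : ι → Ω → ℝ) (b : ι → V) (F : Finset ι) (v : V) (ω : Ω) : ℝ :=
  ∑ f ∈ F with b f = v, ξ f ω

/-- The family `ξ` with the sign of the variables assigned to vertices outside `t` reversed. -/
noncomputable def signedFamily (ξ : ι → Ω → ℝ) (b : ι → V) (t : Finset V) (f : ι) (ω : Ω) : ℝ :=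
  (if b f ∈ t then 1 else -1) * ξ f ω

lemma abs_signedFamily (ξ : ι → Ω → ℝ) (b : ι → V) (t : Finset V) (f : ι) (ω : Ω) :
    |signedFamily ξ b t f ω| = |ξ f ω| := by
  unfold signedFamily
  split_ifs <;> simp

lemma ofReal_sin_eq (x : ℝ) : ((Real.sin x : ℝ) : ℂ)
    = -(Complex.I / 2) * (Complex.exp (Complex.I * (x : ℂ))
      + -Complex.exp (Complex.I * ((-x : ℝ) : ℂ))) := by
  rw [Complex.ofReal_sin, Complex.sin]
  push_cast
  rw [mul_comm Complex.I, mul_comm Complex.I]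
  ring

lemma ofReal_prod_sin_blockSum (ξ : ι → Ω → ℝ) (b : ι → V) (F : Finset ι) (J : Finset V) (ω : Ω) :
    ((∏ v ∈ J, Real.sin (blockSum ξ b F v ω) : ℝ) : ℂ)
      = (-(Complex.I / 2)) ^ J.card * ∑ t ∈ J.powerset,
        (-1) ^ (J \ t).card * expSum (signedFamily ξ b t) (F.filter fun f => b f ∈ J) ω := by
  rw [Complex.ofReal_prod]
  simp_rw [ofReal_sin_eq]
  rw [Finset.prod_mul_distrib, Finset.prod_const, Finset.prod_add]
  congr 1
  refine Finset.sum_congr rfl fun t ht => ?_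
  have htJ := Finset.mem_powerset.1 ht
  rw [Finset.prod_neg, mul_left_comm, ← Complex.exp_sum, ← Complex.exp_sum, ← Complex.exp_add,
    ← Finset.mul_sum, ← Finset.mul_sum, ← mul_add, ← Complex.ofReal_sum, ← Complex.ofReal_sum,
    ← Complex.ofReal_add, expSum]
  congr 4
  have h1 : ∑ f ∈ F with b f ∈ J, signedFamily ξ b t f ω
      = ∑ v ∈ J, (if v ∈ t then 1 else -1) * blockSum ξ b F v ω := by
    rw [← Finset.sum_fiberwise_of_maps_to (s := F.filter fun f => b f ∈ J) (t := J) (g := b)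
      fun f hf => (Finset.mem_filter.1 hf).2]
    refine Finset.sum_congr rfl fun v hv => ?_
    rw [blockSum, Finset.mul_sum, Finset.filter_filter]
    have h2 : (F.filter fun f => b f ∈ J ∧ b f = v) = F.filter fun f => b f = v := by
      refine Finset.filter_congr fun f _ => ⟨fun h => h.2, fun h => ⟨h ▸ hv, h⟩⟩
    rw [h2]
    refine Finset.sum_congr rfl fun f hf => ?_
    rw [signedFamily, (Finset.mem_filter.1 hf).2]
  rw [h1, ← Finset.sum_sdiff htJ, add_comm]
  congr 1
  · refine Finset.sum_congr rfl fun v hv => ?_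
    rw [if_neg (Finset.mem_sdiff.1 hv).2, neg_one_mul]
  · refine Finset.sum_congr rfl fun v hv => ?_
    rw [if_pos hv, one_mul]

variable {I : Type*} {mΩ : MeasurableSpace Ω} {P : Measure Ω} [IsProbabilityMeasure P]
  {m : I → MeasurableSpace Ω} {ξ : ι → Ω → ℝ} {c : ι → Set I} {δ : ℝ}

lemma measurable_signedFamily (b : ι → V)
    (hξm : ∀ g, Measurable[colourSigma m (c g)] (ξ g)) (t : Finset V) (f : ι) :
    Measurable[colourSigma m (c f)] (signedFamily ξ b t f) :=
  (hξm f).const_mul _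

/-- A product of sines is a signed average of exponentials in which the signs cancel, so it has a
small mean as soon as all of the exponentials have nearly the same mean. -/
lemma abs_integral_mul_prod_sin_le (b : ι → V) (hξM : ∀ g, Measurable (ξ g)) (F : Finset ι)
    {J : Finset V} (hJ : J.Nonempty) {Q : Ω → ℝ} (hQM : Measurable Q) {q : ℝ}
    (hQ : ∀ ω, |Q ω| ≤ q) {a : ℂ} {B : ℝ}
    (hB : ∀ t ∈ J.powerset, ‖∫ ω, (Q ω : ℂ) *
      expSum (signedFamily ξ b t) (F.filter fun f => b f ∈ J) ω ∂P - a‖ ≤ B) :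
    |∫ ω, Q ω * ∏ v ∈ J, Real.sin (blockSum ξ b F v ω) ∂P| ≤ B := by
  have hEM : ∀ t, Measurable (expSum (signedFamily ξ b t) (F.filter fun f => b f ∈ J)) := by
    intro t
    have h : Measurable fun ω => ∑ f ∈ F with b f ∈ J, signedFamily ξ b t f ω :=
      Finset.measurable_fun_sum _ fun f _ => (hξM f).const_mul _
    exact Complex.measurable_exp.comp ((Complex.measurable_ofReal.comp h).const_mul Complex.I)
  have hint : ∀ t, Integrable (fun ω => (Q ω : ℂ) *
      expSum (signedFamily ξ b t) (F.filter fun f => b f ∈ J) ω) P := by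
    intro t
    refine integrable_of_norm_le (C := q) (by have := hEM t; fun_prop) fun ω => ?_
    rw [norm_mul, norm_expSum, mul_one, Complex.norm_real]
    exact hQ ω
  have h1 : ((∫ ω, Q ω * ∏ v ∈ J, Real.sin (blockSum ξ b F v ω) ∂P : ℝ) : ℂ)
      = (-(Complex.I / 2)) ^ J.card * ∑ t ∈ J.powerset, (-1) ^ (J \ t).card *
        (∫ ω, (Q ω : ℂ) *
          expSum (signedFamily ξ b t) (F.filter fun f => b f ∈ J) ω ∂P - a) := by
    have hcancel : ∑ t ∈ J.powerset, (-1 : ℂ) ^ (J \ t).card * a = 0 := by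
      have h := Finset.prod_add (fun _ : V => (1 : ℂ)) (fun _ => -1) J
      simp only [add_neg_cancel, Finset.prod_const, one_pow, one_mul] at h
      rw [← Finset.sum_mul, ← h, zero_pow (Finset.card_ne_zero.2 hJ), zero_mul]
    simp_rw [mul_sub, Finset.sum_sub_distrib, hcancel, sub_zero]
    rw [← integral_complex_ofReal]
    simp_rw [Complex.ofReal_mul, ofReal_prod_sin_blockSum]
    rw [Finset.mul_sum]
    simp_rw [← integral_const_mul]
    rw [← integral_finsetSum]
    · refine integral_congr_ae (ae_of_all _ fun ω => ?_)
      simp only [Finset.mul_sum]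
      refine Finset.sum_congr rfl fun t _ => ?_
      ring
    · intro t _
      exact ((hint t).const_mul _).const_mul _
  have h2 := congrArg norm h1
  rw [Complex.norm_real, Real.norm_eq_abs] at h2
  rw [h2, norm_mul, norm_pow, norm_neg, norm_div, Complex.norm_I, Complex.norm_ofNat]
  have h3 : ‖∑ t ∈ J.powerset, (-1 : ℂ) ^ (J \ t).card *
        (∫ ω, (Q ω : ℂ) *
          expSum (signedFamily ξ b t) (F.filter fun f => b f ∈ J) ω ∂P - a)‖ ≤ 2 ^ J.card * B := by
    refine (norm_sum_le_of_le _ (f := fun t => (-1 : ℂ) ^ (J \ t).card *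
        (∫ ω, (Q ω : ℂ) *
          expSum (signedFamily ξ b t) (F.filter fun f => b f ∈ J) ω ∂P - a))
      (n := fun _ => B) fun t ht => ?_).trans ?_
    · rw [norm_mul, norm_pow, norm_neg, norm_one, one_pow, one_mul]
      exact hB t ht
    · rw [Finset.sum_const, Finset.card_powerset, nsmul_eq_mul]
      push_cast
      exact le_rfl
  calc _ ≤ (1 / 2 : ℝ) ^ J.card * (2 ^ J.card * B) := by gcongr
    _ = B := by rw [← mul_assoc, ← mul_pow]; norm_num

lemma abs_integral_centred_mul_prod_sin_le (hm : ∀ i, m i ≤ mΩ) (hind : iIndep m P) (b : ι → V)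
    (hξm : ∀ g, Measurable[colourSigma m (c g)] (ξ g)) (hξ : ∀ g ω, |ξ g ω| ≤ δ) (hδ : 0 ≤ δ)
    (F : Finset ι) {J : Finset V} (hJ : J.Nonempty) {Q : Ω → ℝ} {cQ : Set I}
    (hQm : Measurable[colourSigma m cQ] Q)
    (hQ : ∀ ω, |Q ω| ≤ 1) (hQ0 : ∫ ω, Q ω ∂P = 0) {M : ℝ}
    (hNQ : ((neighbours c (F.filter fun f => b f ∈ J) cQ).card : ℝ) ≤ M)
    (hN : ∀ g ∈ F, b g ∈ J →
      ((neighbours c (F.filter fun f => b f ∈ J) (c g)).card : ℝ) ≤ M) :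
    |∫ ω, Q ω * ∏ v ∈ J, Real.sin (blockSum ξ b F v ω) ∂P| ≤ M * δ + 4 * M ^ 2 * δ ^ 2 := by
  have hξM : ∀ g, Measurable (ξ g) := fun g => (hξm g).mono (colourSigma_le hm _) le_rfl
  refine abs_integral_mul_prod_sin_le b hξM F hJ (hQm.mono (colourSigma_le hm _) le_rfl) hQ
    (a := 0) fun t _ => ?_
  have hsm := measurable_signedFamily b hξm t
  have hs : ∀ g ω, |signedFamily ξ b t g ω| ≤ δ := fun g ω => by
    rw [abs_signedFamily]; exact hξ g ω
  set FJ := F.filter fun f => b f ∈ J with hFJ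
  have h1 := norm_integral_mul_expSum_sub_le hm hind hsm hs FJ hQm hQ hQ0 hNQ fun g hg =>
    hN g (Finset.mem_filter.1 hg).1 (Finset.mem_filter.1 hg).2
  have h2 := abs_integral_mul_sum_le hm hind hsm hs hδ FJ hQm zero_le_one hQ hQ0 hNQ
  have h3 : ‖∫ ω, expSum (signedFamily ξ b t) FJ ω ∂P‖ ≤ 1 :=
    norm_integral_le_of_forall_norm_le fun ω => (norm_expSum _ _ _).le
  rw [sub_zero]
  set A := ∫ ω, (Q ω : ℂ) * expSum (signedFamily ξ b t) FJ ω ∂P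
  set y := ∫ ω, Q ω * ∑ g ∈ FJ, signedFamily ξ b t g ω ∂P
  set E := ∫ ω, expSum (signedFamily ξ b t) FJ ω ∂P
  have h4 : ‖Complex.I * (y : ℂ) * E‖ ≤ M * 1 * δ := by
    rw [norm_mul, norm_mul, Complex.norm_I, one_mul, Complex.norm_real, Real.norm_eq_abs]
    exact (mul_le_of_le_one_right (abs_nonneg _) h3).trans h2
  have h5 := norm_add_le (A - Complex.I * (y : ℂ) * E) (Complex.I * (y : ℂ) * E)
  rw [sub_add_cancel] at h5
  linarith

/-- The block sums belonging to different vertices are nearly independent when they are nearly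
uncorrelated: all their signed sums are nearly Gaussian, with nearly the same variance. -/
lemma abs_integral_prod_sin_le (hm : ∀ i, m i ≤ mΩ) (hind : iIndep m P) (b : ι → V)
    (hξm : ∀ g, Measurable[colourSigma m (c g)] (ξ g)) (hξ : ∀ g ω, |ξ g ω| ≤ δ) (hδ : 0 ≤ δ)
    (hξ0 : ∀ g, ∫ ω, ξ g ω ∂P = 0)
    (F : Finset ι) {J : Finset V} (hJ : J.Nonempty) {M : ℝ}
    (hN : ∀ g ∈ F, b g ∈ J →
      ((neighbours c (F.filter fun f => b f ∈ J) (c g)).card : ℝ) ≤ M) :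
    |∫ ω, ∏ v ∈ J, Real.sin (blockSum ξ b F v ω) ∂P|
      ≤ 4 * (F.filter fun f => b f ∈ J).card * M ^ 2 * δ ^ 3
        + (∑ f ∈ F with b f ∈ J, ∑ g ∈ F with b g ∈ J,
          if b f = b g then 0 else |∫ ω, ξ f ω * ξ g ω ∂P|) / 2 := by
  have hξM : ∀ g, Measurable (ξ g) := fun g => (hξm g).mono (colourSigma_le hm _) le_rfl
  set FJ := F.filter fun f => b f ∈ J with hFJ
  set v₀ : ℝ := ∑ f ∈ FJ, ∑ g ∈ FJ, if b f = b g then ∫ ω, ξ f ω * ξ g ω ∂P else 0 with hv₀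
  set R : ℝ := ∑ f ∈ FJ, ∑ g ∈ FJ, if b f = b g then 0 else |∫ ω, ξ f ω * ξ g ω ∂P| with hR
  -- the variance of the sum of the blocks of `J`, as if they were uncorrelated
  have hv₀0 : 0 ≤ v₀ := by
    have h1 : v₀ = ∑ u ∈ J, ∫ ω, blockSum ξ b FJ u ω ^ 2 ∂P := by
      have h2 : ∀ u ∈ J, ∫ ω, blockSum ξ b FJ u ω ^ 2 ∂P
          = ∑ f ∈ FJ with b f = u, ∑ g ∈ FJ with b g = u, ∫ ω, ξ f ω * ξ g ω ∂P := by
        intro u _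
        simp_rw [blockSum, sq, Finset.sum_mul_sum]
        rw [integral_finsetSum]
        · refine Finset.sum_congr rfl fun f _ => integral_finsetSum _ fun g _ => ?_
          refine integrable_of_norm_le (C := δ * δ) ((hξM f).mul (hξM g)) fun ω => ?_
          rw [norm_mul]
          exact mul_le_mul (hξ f ω) (hξ g ω) (norm_nonneg _) hδ
        · intro f _
          refine integrable_finsetSum _ fun g _ => ?_
          refine integrable_of_norm_le (C := δ * δ) ((hξM f).mul (hξM g)) fun ω => ?_
          rw [norm_mul]
          exact mul_le_mul (hξ f ω) (hξ g ω) (norm_nonneg _) hδ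
      rw [Finset.sum_congr rfl h2, hv₀, ← Finset.sum_fiberwise_of_maps_to (t := J) (g := b)
        fun f hf => (Finset.mem_filter.1 hf).2]
      refine Finset.sum_congr rfl fun u _ => Finset.sum_congr rfl fun f hf => ?_
      rw [(Finset.mem_filter.1 hf).2]
      refine Eq.trans ?_ (Finset.sum_filter _ _).symm
      exact Finset.sum_congr rfl fun g _ => by simp only [eq_comm (a := u)]
    rw [h1]
    exact Finset.sum_nonneg fun u _ => integral_nonneg fun ω => sq_nonneg _
  have hmain : ∀ t ∈ J.powerset, ‖∫ ω, (((1 : ℝ)) : ℂ) * expSum (signedFamily ξ b t) FJ ω ∂P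
      - (Real.exp (-v₀ / 2) : ℂ)‖ ≤ 4 * FJ.card * M ^ 2 * δ ^ 3 + R / 2 := by
    intro t _
    have hs : ∀ g ω, |signedFamily ξ b t g ω| ≤ δ := fun g ω => by
      rw [abs_signedFamily]; exact hξ g ω
    have hclt := norm_integral_expSum_sub_exp_le hm hind (measurable_signedFamily b hξm t) hs hδ
      (fun g => by simp only [signedFamily]; rw [integral_const_mul, hξ0, mul_zero]) FJ
      fun g hg => hN g (Finset.mem_filter.1 hg).1 (Finset.mem_filter.1 hg).2
    set v₁ := ∫ ω, (∑ g ∈ FJ, signedFamily ξ b t g ω) ^ 2 ∂P with hv₁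
    have hv₁0 : 0 ≤ v₁ := integral_nonneg fun ω => sq_nonneg _
    have hdiff : |v₁ - v₀| ≤ R := by
      have h1 : v₁ = ∑ f ∈ FJ, ∑ g ∈ FJ, (if b f ∈ t then 1 else -1) *
          (if b g ∈ t then 1 else -1) * ∫ ω, ξ f ω * ξ g ω ∂P := by
        have hi : ∀ f g, Integrable (fun ω => signedFamily ξ b t f ω * signedFamily ξ b t g ω) P :=
          fun f g => integrable_of_norm_le (C := δ * δ)
            (((hξM f).const_mul _).mul ((hξM g).const_mul _)) fun ω => by
              rw [norm_mul]
              exact mul_le_mul (hs f ω) (hs g ω) (norm_nonneg _) hδ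
        simp_rw [hv₁, sq, Finset.sum_mul_sum]
        rw [integral_finsetSum _ fun f _ => integrable_finsetSum _ fun g _ => hi f g]
        refine Finset.sum_congr rfl fun f _ => ?_
        rw [integral_finsetSum _ fun g _ => hi f g]
        refine Finset.sum_congr rfl fun g _ => ?_
        rw [← integral_const_mul]
        refine integral_congr_ae (ae_of_all _ fun ω => ?_)
        simp only [signedFamily]
        ring
      rw [h1, hv₀, hR, ← Finset.sum_sub_distrib]
      refine (Finset.abs_sum_le_sum_abs _ _).trans (Finset.sum_le_sum fun f _ => ?_)
      rw [← Finset.sum_sub_distrib]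
      refine (Finset.abs_sum_le_sum_abs _ _).trans (Finset.sum_le_sum fun g _ => ?_)
      by_cases h : b f = b g
      · rw [if_pos h, if_pos h, h]
        split_ifs <;> simp
      · rw [if_neg h, if_neg h]
        split_ifs <;> simp
    have hexp : |Real.exp (-v₁ / 2) - Real.exp (-v₀ / 2)| ≤ |v₁ - v₀| / 2 := by
      have hmono : ∀ x y : ℝ, 0 ≤ x → x ≤ y →
          |Real.exp (-x / 2) - Real.exp (-y / 2)| ≤ |x - y| / 2 := by
        intro x y hx hxy
        have h1 : Real.exp (-y / 2) ≤ Real.exp (-x / 2) := Real.exp_le_exp.2 (by linarith)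
        rw [abs_of_nonneg (sub_nonneg.2 h1), abs_of_nonpos (by linarith)]
        have h2 : Real.exp (-y / 2) = Real.exp (-x / 2) * Real.exp (-(y - x) / 2) := by
          rw [← Real.exp_add]; ring_nf
        have h3 := Real.add_one_le_exp (-(y - x) / 2)
        have h4 : Real.exp (-x / 2) ≤ 1 := Real.exp_le_one_iff.2 (by linarith)
        have h5 : 0 < Real.exp (-x / 2) := Real.exp_pos _
        rw [h2]
        nlinarith
      rcases le_total v₁ v₀ with h | h
      · exact hmono _ _ hv₁0 h
      · rw [abs_sub_comm, abs_sub_comm v₁]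
        exact hmono _ _ hv₀0 h
    have hexpC : ‖(Real.exp (-v₁ / 2) : ℂ) - (Real.exp (-v₀ / 2) : ℂ)‖ ≤ R / 2 := by
      rw [← Complex.ofReal_sub, Complex.norm_real, Real.norm_eq_abs]
      linarith
    simp only [Complex.ofReal_one, one_mul]
    calc _ ≤ _ := norm_sub_le_norm_sub_add_norm_sub _ (Real.exp (-v₁ / 2) : ℂ) _
      _ ≤ _ := add_le_add hclt hexpC
  have := abs_integral_mul_prod_sin_le b hξM F hJ (measurable_const (a := (1 : ℝ)))
    (fun _ => (abs_one).le) hmain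
  simpa only [one_mul] using this

end ProductsOfSines

/-! ### Random signs on the vertices -/

section RandomSigns

/-- The sign encoded by a Boolean. -/
def boolSign (x : Bool) : ℝ := if x then 1 else -1

lemma boolSign_mul_self (x : Bool) : boolSign x * boolSign x = 1 := by
  cases x <;> simp [boolSign]

lemma abs_boolSign (x : Bool) : |boolSign x| = 1 := by
  cases x <;> simp [boolSign]

/-- The law of independent uniformly random signs on the vertices. -/
noncomputable def signMeasure (V : Type*) [Fintype V] : Measure (V → Bool) :=
  Measure.pi fun _ => (PMF.uniformOfFintype Bool).toMeasure

instance (V : Type*) [Fintype V] : IsProbabilityMeasure (signMeasure V) := by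
  unfold signMeasure
  infer_instance

lemma integral_boolSign {V : Type*} [Fintype V] (v : V) : ∫ x, boolSign (x v) ∂signMeasure V = 0 := by
  have h := measurePreserving_eval (fun _ : V => (PMF.uniformOfFintype Bool).toMeasure) v
  have h1 := integral_map (μ := signMeasure V) h.measurable.aemeasurable (f := boolSign)
    (measurable_of_finite _).aestronglyMeasurable
  refine h1.symm.trans ?_
  rw [signMeasure, h.map_eq, PMF.integral_eq_sum]
  simp [boolSign]

variable {V Ω 𝒮 : Type*} {mΩ : MeasurableSpace Ω}
  {β : 𝒮 → Type*} [∀ i, MeasurableSpace (β i)]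

/-- The σ-algebras on the product of `Ω` with the space of random signs that are generated by the
single colour variables and by the signs of the single vertices. -/
@[reducible]
def jointColour (V : Type*) (Z : ∀ i, Ω → β i) : 𝒮 ⊕ V → MeasurableSpace (Ω × (V → Bool))
  | .inl i => ((inferInstance : MeasurableSpace (β i)).comap (Z i)).comap Prod.fst
  | .inr v => ((inferInstance : MeasurableSpace Bool).comap fun x : V → Bool => x v).comap Prod.snd

lemma jointColour_le {Z : ∀ i, Ω → β i} (hZ : ∀ i, Measurable (Z i)) (i : 𝒮 ⊕ V) :
    jointColour V Z i ≤ (inferInstance : MeasurableSpace (Ω × (V → Bool))) := by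
  rcases i with i | v
  · exact (MeasurableSpace.comap_mono (hZ i).comap_le).trans measurable_fst.comap_le
  · exact (MeasurableSpace.comap_mono (measurable_pi_apply v).comap_le).trans measurable_snd.comap_le

lemma measurable_boolSign_colourSigma (Z : ∀ i, Ω → β i) {S : Set (𝒮 ⊕ V)} {v : V}
    (hv : Sum.inr v ∈ S) :
    Measurable[colourSigma (jointColour V Z) S] fun q : Ω × (V → Bool) => boolSign (q.2 v) := by
  have h : Measurable[jointColour V Z (.inr v)] fun q : Ω × (V → Bool) => boolSign (q.2 v) := by
    intro A hA
    refine ⟨(fun x : V → Bool => x v) ⁻¹' (boolSign ⁻¹' A), ⟨boolSign ⁻¹' A, ?_, rfl⟩, rfl⟩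
    exact measurable_of_finite boolSign hA
  exact h.mono (le_colourSigma _ hv) le_rfl

variable [Fintype V] {μ : Measure Ω} [IsProbabilityMeasure μ]

lemma iIndep_jointColour {Z : ∀ i, Ω → β i} (hind : iIndepFun Z μ) :
    iIndep (jointColour V Z) (μ.prod (signMeasure V)) := by
  classical
  rw [iIndep_iff]
  intro s f hf
  have hL : ∀ i, ∃ a : Set Ω, Sum.inl i ∈ s →
      MeasurableSet[(inferInstance : MeasurableSpace (β i)).comap (Z i)] a
        ∧ Prod.fst ⁻¹' a = f (.inl i) := by
    intro i
    by_cases h : Sum.inl i ∈ s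
    · obtain ⟨a, ha⟩ := hf _ h
      exact ⟨a, fun _ => ha⟩
    · exact ⟨∅, fun h' => absurd h' h⟩
  have hR : ∀ v : V, ∃ a : Set (V → Bool), Sum.inr v ∈ s →
      MeasurableSet[(inferInstance : MeasurableSpace Bool).comap fun x : V → Bool => x v] a
        ∧ Prod.snd ⁻¹' a = f (.inr v) := by
    intro v
    by_cases h : Sum.inr v ∈ s
    · obtain ⟨a, ha⟩ := hf _ h
      exact ⟨a, fun _ => ha⟩
    · exact ⟨∅, fun h' => absurd h' h⟩
  choose a ha using hL
  choose a' ha' using hR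
  have hset : (⋂ i ∈ s, f i) = (⋂ i ∈ s.toLeft, a i) ×ˢ (⋂ v ∈ s.toRight, a' v) := by
    ext ⟨ω, x⟩
    simp only [Set.mem_iInter, Set.mem_prod, Finset.mem_toLeft, Finset.mem_toRight]
    constructor
    · intro h
      exact ⟨fun i hi => by have := h _ hi; rwa [← (ha i hi).2] at this,
        fun v hv => by have := h _ hv; rwa [← (ha' v hv).2] at this⟩
    · rintro ⟨h1, h2⟩ (i | v) hi
      · rw [← (ha i hi).2]; exact h1 i hi
      · rw [← (ha' v hi).2]; exact h2 v hi
  have hsigns : iIndepFun (fun (v : V) (x : V → Bool) => x v) (signMeasure V) :=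
    iIndepFun_pi (X := fun _ => id) fun _ => aemeasurable_id
  rw [hset, Measure.prod_prod,
    ((iIndep_iff _ _).1 ((iIndepFun_iff_iIndep _ _ _).1 hind)) _ fun i hi =>
      (ha i (Finset.mem_toLeft.1 hi)).1,
    ((iIndep_iff _ _).1 ((iIndepFun_iff_iIndep _ _ _).1 hsigns)) _ fun v hv =>
      (ha' v (Finset.mem_toRight.1 hv)).1]
  have hs : s = s.toLeft.disjSum s.toRight := (Finset.toLeft_disjSum_toRight).symm
  conv_rhs => rw [hs, Finset.prod_disjSum]
  congr 1
  · refine Finset.prod_congr rfl fun i hi => ?_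
    rw [← (ha i (Finset.mem_toLeft.1 hi)).2, ← Set.prod_univ, Measure.prod_prod, measure_univ,
      mul_one]
  · refine Finset.prod_congr rfl fun v hv => ?_
    rw [← (ha' v (Finset.mem_toRight.1 hv)).2, ← Set.univ_prod, Measure.prod_prod, measure_univ,
      one_mul]

/-- Integrating out the sign of a vertex on which the other factor does not depend gives zero. -/
lemma integral_mul_boolSign_eq_zero {Z : ∀ i, Ω → β i} (hZ : ∀ i, Measurable (Z i))
    (hind : iIndepFun Z μ) {S : Set (𝒮 ⊕ V)} {v : V} (hv : Sum.inr v ∉ S)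
    {Q : Ω × (V → Bool) → ℝ} (hQ : Measurable[colourSigma (jointColour V Z) S] Q) :
    ∫ q, Q q * boolSign (q.2 v) ∂μ.prod (signMeasure V) = 0 := by
  rw [integral_mul_of_disjoint_colours (jointColour_le hZ) (iIndep_jointColour hind)
    (Set.disjoint_singleton_right.2 hv) hQ
    (measurable_boolSign_colourSigma Z (Set.mem_singleton _)),
    integral_fun_snd (fun x : V → Bool => boolSign (x v)), integral_boolSign, smul_zero, mul_zero]

end RandomSigns

/-! ### Oriented hyperedges and codegree counts -/

namespace ColouredHyperedges

lemma IsLinearType.mono {V X 𝒮 Ω : Type*} [Fintype X] [MeasurableSpace Ω]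
    {β : 𝒮 → Type*} [∀ i, MeasurableSpace (β i)] {G : ColouredHyperedges V X 𝒮} {μ : Measure Ω}
    {Z : ∀ i, Ω → β i} {R : Ω → Finset X} {m Δ : ℝ} {k : ℕ} {C C' c p D D' : ℝ}
    (h : G.IsLinearType μ Z R m Δ k C c p D) (hm : 0 ≤ m) (hC : C ≤ C') (hD : D ≤ D') :
    G.IsLinearType μ Z R m Δ k C' c p D' where
  card_verts_le := h.card_verts_le
  card_le := h.card_le.trans (by gcongr)
  measurable_colour := h.measurable_colour
  indep := h.indep
  card_colours_le := h.card_colours_le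
  determined := h.determined
  correlation := h.correlation
  gain := h.gain
  degree_le := h.degree_le
  codegree_le := fun u v huv => (h.codegree_le u v huv).trans hD
  colour_codegree_le := fun u i => (h.colour_codegree_le u i).trans hD

/-- Every hyperedge `f ∈ Y` contains the vertex `b f` of `B` and the vertex `a f` outside `B`. -/
structure IsOriented {V X 𝒮 : Type*} (G : ColouredHyperedges V X 𝒮) (Y : Finset X) (a b : X → V)
    (B : Finset V) : Prop where
  tail_mem : ∀ f ∈ Y, a f ∈ G.verts f
  head_mem : ∀ f ∈ Y, b f ∈ G.verts f
  tail_notMem : ∀ f ∈ Y, a f ∉ B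
  head_mem_part : ∀ f ∈ Y, b f ∈ B

open scoped Classical

/-- A uniformly random `B` separates a chosen pair of vertices of each hyperedge with probability
one half, so some `B` separates the chosen pairs of at least half of the hyperedges. -/
lemma exists_isOriented {V X 𝒮 : Type*} [Fintype V] [Nonempty V] (G : ColouredHyperedges V X 𝒮)
    (Y : Finset X) (hY : ∀ e ∈ Y, 2 ≤ (G.verts e).card) :
    ∃ (Y' : Finset X) (a b : X → V) (B : Finset V),
      Y' ⊆ Y ∧ Y.card ≤ 2 * Y'.card ∧ G.IsOriented Y' a b B := by
  have hpair : ∀ e, ∃ w : V × V, e ∈ Y → w.1 ∈ G.verts e ∧ w.2 ∈ G.verts e ∧ w.1 ≠ w.2 := by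
    intro e
    by_cases he : e ∈ Y
    · obtain ⟨u, hu, v, hv, huv⟩ := Finset.one_lt_card.1 (hY e he)
      exact ⟨(u, v), fun _ => ⟨hu, hv, huv⟩⟩
    · exact ⟨Classical.arbitrary _, fun h => absurd h he⟩
  choose w hw using hpair
  have hmeas : ∀ v : V, Measurable fun x : V → Bool => boolSign (x v) :=
    fun v => measurable_of_finite _
  have hint : ∀ e, Integrable (fun x : V → Bool => boolSign (x (w e).1) * boolSign (x (w e).2))
      (signMeasure V) := fun e =>
    integrable_of_norm_le (C := 1) ((hmeas _).mul (hmeas _)) fun x => by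
      rw [norm_mul, Real.norm_eq_abs, Real.norm_eq_abs, abs_boolSign, abs_boolSign, one_mul]
  have hzero : ∀ e ∈ Y,
      ∫ x : V → Bool, boolSign (x (w e).1) * boolSign (x (w e).2) ∂signMeasure V = 0 := by
    intro e he
    have hsigns : iIndepFun (fun (v : V) (x : V → Bool) => x v) (signMeasure V) :=
      iIndepFun_pi (X := fun _ => id) fun _ => aemeasurable_id
    have hi := (hsigns.indepFun (hw e he).2.2).comp (φ := boolSign) (ψ := boolSign)
      (measurable_of_finite _) (measurable_of_finite _)
    have h2 := hi.integral_fun_mul_eq_mul_integral (hmeas _).aestronglyMeasurable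
      (hmeas _).aestronglyMeasurable
    simp only [Function.comp_apply] at h2
    rw [h2, integral_boolSign, zero_mul]
  obtain ⟨x, hx⟩ := exists_le_integral (μ := signMeasure V)
    (f := fun x => ∑ e ∈ Y, boolSign (x (w e).1) * boolSign (x (w e).2))
    (integrable_finsetSum _ fun e _ => hint e)
  rw [integral_finsetSum _ fun e _ => hint e, Finset.sum_eq_zero hzero] at hx
  refine ⟨Y.filter fun e => x (w e).1 ≠ x (w e).2,
    fun e => if x (w e).1 then (w e).2 else (w e).1,
    fun e => if x (w e).1 then (w e).1 else (w e).2,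
    Finset.univ.filter fun v => x v = true, Finset.filter_subset _ _, ?_, ?_, ?_, ?_, ?_⟩
  · have h1 : ∀ e ∈ Y, boolSign (x (w e).1) * boolSign (x (w e).2)
        = 1 - 2 * if x (w e).1 ≠ x (w e).2 then (1 : ℝ) else 0 := by
      intro e _
      cases x (w e).1 <;> cases x (w e).2 <;> simp [boolSign] <;> norm_num
    rw [Finset.sum_congr rfl h1, Finset.sum_sub_distrib, ← Finset.mul_sum, Finset.sum_boole,
      Finset.sum_const, nsmul_eq_mul, mul_one] at hx
    have : (Y.card : ℝ) ≤ 2 * ((Y.filter fun e => x (w e).1 ≠ x (w e).2).card : ℝ) := by linarith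
    exact_mod_cast this
  all_goals
    intro e he
    obtain ⟨heY, hne⟩ := Finset.mem_filter.1 he
    have h := hw e heY
  · split_ifs
    exacts [h.2.1, h.1]
  · split_ifs
    exacts [h.1, h.2.1]
  · cases h1 : x (w e).1 <;> cases h2 : x (w e).2 <;> simp_all
  · cases h1 : x (w e).1 <;> cases h2 : x (w e).2 <;> simp_all

section Setup

variable {V X 𝒮 Ω : Type*}

/-- The indicator of the event that the potential hyperedge `e` is present. -/
noncomputable def edgeInd (R : Ω → Finset X) (e : X) (ω : Ω) : ℝ :=
  if e ∈ R ω then 1 else 0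

lemma edgeInd_nonneg (R : Ω → Finset X) (e : X) (ω : Ω) : 0 ≤ edgeInd R e ω := by
  unfold edgeInd; split_ifs <;> norm_num

lemma edgeInd_le_one (R : Ω → Finset X) (e : X) (ω : Ω) : edgeInd R e ω ≤ 1 := by
  unfold edgeInd; split_ifs <;> norm_num

lemma edgeInd_mul (R : Ω → Finset X) (e f : X) (ω : Ω) :
    edgeInd R e ω * edgeInd R f ω = if e ∈ R ω ∧ f ∈ R ω then 1 else 0 := by
  unfold edgeInd
  by_cases h1 : e ∈ R ω <;> by_cases h2 : f ∈ R ω <;> simp [h1, h2]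

variable [MeasurableSpace Ω] {β : 𝒮 → Type*} [∀ i, MeasurableSpace (β i)]
  {G : ColouredHyperedges V X 𝒮} {μ : Measure Ω} {Z : ∀ i, Ω → β i}
  {R : Ω → Finset X} {m Δ : ℝ} {k : ℕ} {C c p D : ℝ}

/-- The fluctuation of the indicator of `f`, scaled by `δ` and multiplied by the random sign of
the vertex `a f`. -/
noncomputable def signedFluctuation (μ : Measure Ω) (R : Ω → Finset X) (a : X → V) (δ : ℝ) (f : X)
    (q : Ω × (V → Bool)) : ℝ :=
  δ * ((edgeInd R f q.1 - μ.real {ω | f ∈ R ω}) * boolSign (q.2 (a f)))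

lemma abs_edgeInd_sub_le [IsProbabilityMeasure μ] (e : X) (ω : Ω) : |edgeInd R e ω - μ.real {ω | e ∈ R ω}| ≤ 1 := by
  have h1 := edgeInd_nonneg R e ω
  have h2 := edgeInd_le_one R e ω
  have h3 : 0 ≤ μ.real {ω | e ∈ R ω} := measureReal_nonneg
  have h4 : μ.real {ω | e ∈ R ω} ≤ 1 := measureReal_le_one
  rw [abs_le]
  constructor <;> linarith

lemma abs_signedFluctuation_le [IsProbabilityMeasure μ] (a : X → V) {δ : ℝ} (hδ : 0 ≤ δ) (f : X) (q : Ω × (V → Bool)) :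
    |signedFluctuation μ R a δ f q| ≤ δ := by
  rw [signedFluctuation, abs_mul, abs_mul, abs_boolSign, mul_one, abs_of_nonneg hδ]
  exact mul_le_of_le_one_right hδ (abs_edgeInd_sub_le f q.1)

variable [Fintype X]

/-- The colours of `f` together with the vertex `a f`: the signed fluctuation of `f` is a function
of the variables attached to these. -/
def extendedColours (G : ColouredHyperedges V X 𝒮) (a : X → V) (f : X) : Set (𝒮 ⊕ V) :=
  ((G.colours f).disjSum {a f} : Finset (𝒮 ⊕ V))

lemma measurable_edgeInd_colourSigma (h : G.IsLinearType μ Z R m Δ k C c p D) {e : X}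
    {S : Set (𝒮 ⊕ V)} (hS : ∀ i ∈ G.colours e, Sum.inl i ∈ S) :
    Measurable[colourSigma (jointColour V Z) S]
      fun q : Ω × (V → Bool) => edgeInd R e q.1 := by
  obtain ⟨A, hA, hAR⟩ := h.determined e
  have ht : Measurable[colourSigma (jointColour V Z) S]
      fun (q : Ω × (V → Bool)) (i : G.colours e) => Z i q.1 := by
    refine @measurable_pi_lambda _ _ _ (colourSigma (jointColour V Z) S) _ _ fun i => ?_
    intro T hT
    exact le_colourSigma (jointColour V Z) (hS i i.2) _ ⟨Z i ⁻¹' T, ⟨T, hT, rfl⟩, rfl⟩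
  have hset : MeasurableSet[colourSigma (jointColour V Z) S]
      {q : Ω × (V → Bool) | e ∈ R q.1} := by
    have : {q : Ω × (V → Bool) | e ∈ R q.1}
        = (fun (q : Ω × (V → Bool)) (i : G.colours e) => Z i q.1) ⁻¹' A := by
      ext q; exact hAR q.1
    rw [this]
    exact ht hA
  unfold edgeInd
  exact Measurable.ite hset measurable_const measurable_const

lemma measurableSet_mem (h : G.IsLinearType μ Z R m Δ k C c p D) (e : X) :
    MeasurableSet {ω | e ∈ R ω} := by
  obtain ⟨A, hA, hAR⟩ := h.determined e
  have ht : Measurable fun (ω : Ω) (i : G.colours e) => Z i ω :=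
    measurable_pi_lambda _ fun i => h.measurable_colour i
  have : {ω | e ∈ R ω} = (fun (ω : Ω) (i : G.colours e) => Z i ω) ⁻¹' A := by
    ext ω; exact hAR ω
  rw [this]
  exact ht hA

lemma measurable_edgeInd (h : G.IsLinearType μ Z R m Δ k C c p D) (e : X) :
    Measurable (edgeInd R e) :=
  Measurable.ite (measurableSet_mem h e) measurable_const measurable_const

lemma measurable_signedFluctuation (h : G.IsLinearType μ Z R m Δ k C c p D) (a : X → V) (δ : ℝ)
    (f : X) : Measurable[colourSigma (jointColour V Z) (extendedColours G a f)]
      (signedFluctuation μ R a δ f) := by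
  have h1 := measurable_edgeInd_colourSigma h (e := f) (S := extendedColours G a f)
    (fun i hi => by simpa [extendedColours] using hi)
  have h2 := measurable_boolSign_colourSigma Z (S := extendedColours G a f) (v := a f)
    (by simp [extendedColours])
  exact ((h1.sub_const _).mul h2).const_mul _

lemma integral_edgeInd (h : G.IsLinearType μ Z R m Δ k C c p D) (e : X) :
    ∫ ω, edgeInd R e ω ∂μ = μ.real {ω | e ∈ R ω} := by
  have h1 : edgeInd R e = Set.indicator {ω | e ∈ R ω} 1 := by
    ext ω; simp [edgeInd, Set.indicator_apply]
  rw [h1, integral_indicator_one (measurableSet_mem h e)]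

lemma integral_edgeInd_mul (h : G.IsLinearType μ Z R m Δ k C c p D) (e f : X) :
    ∫ ω, edgeInd R e ω * edgeInd R f ω ∂μ = μ.real {ω | e ∈ R ω ∧ f ∈ R ω} := by
  have h1 : (fun ω => edgeInd R e ω * edgeInd R f ω)
      = Set.indicator {ω | e ∈ R ω ∧ f ∈ R ω} 1 := by
    ext ω; rw [edgeInd_mul]; simp [Set.indicator_apply]
  exact (congrArg (integral μ) h1).trans
    (integral_indicator_one ((measurableSet_mem h e).inter (measurableSet_mem h f)))

/-- The potential hyperedges through a set `J` of heads that share an extended colour with given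
colours `S` or given vertices `T` are few, by the codegree conditions. -/
lemma card_neighbours_le (h : G.IsLinearType μ Z R m Δ k C c p D) (hD : 0 ≤ D) {Y : Finset X}
    {a b : X → V} {B : Finset V} (hO : G.IsOriented Y a b B) {F : Finset X} {J : Finset V}
    (hF : ∀ f ∈ F, f ∈ Y ∧ b f ∈ J) (hJ : J.card ≤ k) {S : Finset 𝒮} (hS : S.card ≤ k)
    {T : Finset V} (hT : T.card ≤ k) :
    ((neighbours (extendedColours G a) F ((S.disjSum T : Finset (𝒮 ⊕ V)) : Set (𝒮 ⊕ V))).card : ℝ)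
      ≤ 2 * k ^ 2 * D := by
  have hsub : neighbours (extendedColours G a) F ((S.disjSum T : Finset (𝒮 ⊕ V)) : Set (𝒮 ⊕ V))
      ⊆ (J ×ˢ S).biUnion (fun w => Finset.univ.filter fun e => w.1 ∈ G.verts e ∧ w.2 ∈ G.colours e)
        ∪ ((J ×ˢ T).filter fun w => w.1 ≠ w.2).biUnion
          (fun w => Finset.univ.filter fun e => w.1 ∈ G.verts e ∧ w.2 ∈ G.verts e) := by
    intro f hf
    obtain ⟨hfF, hnd⟩ := Finset.mem_filter.1 hf
    obtain ⟨hfY, hfJ⟩ := hF f hfF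
    rw [extendedColours, Finset.disjoint_coe, Finset.not_disjoint_iff] at hnd
    obtain ⟨i | v, hi, hi'⟩ := hnd
    · rw [Finset.inl_mem_disjSum] at hi hi'
      refine Finset.mem_union_left _ (Finset.mem_biUnion.2 ⟨(b f, i), ?_, ?_⟩)
      · exact Finset.mem_product.2 ⟨hfJ, hi'⟩
      · exact Finset.mem_filter.2 ⟨Finset.mem_univ _, hO.head_mem f hfY, hi⟩
    · rw [Finset.inr_mem_disjSum] at hi hi'
      obtain rfl := Finset.mem_singleton.1 hi
      refine Finset.mem_union_right _ (Finset.mem_biUnion.2 ⟨(b f, a f), ?_, ?_⟩)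
      · refine Finset.mem_filter.2 ⟨Finset.mem_product.2 ⟨hfJ, hi'⟩, fun (hab : b f = a f) => ?_⟩
        exact hO.tail_notMem f hfY (hab ▸ hO.head_mem_part f hfY)
      · exact Finset.mem_filter.2 ⟨Finset.mem_univ _, hO.head_mem f hfY, hO.tail_mem f hfY⟩
  have h1 : (((J ×ˢ S).biUnion (fun w => Finset.univ.filter fun e =>
      w.1 ∈ G.verts e ∧ w.2 ∈ G.colours e)).card : ℝ) ≤ k ^ 2 * D := by
    calc _ ≤ ∑ w ∈ J ×ˢ S, ((Finset.univ.filter fun e =>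
            w.1 ∈ G.verts e ∧ w.2 ∈ G.colours e).card : ℝ) := by
          exact_mod_cast Finset.card_biUnion_le
      _ ≤ (J ×ˢ S).card • D := Finset.sum_le_card_nsmul _ _ _ fun w _ =>
          h.colour_codegree_le w.1 w.2
      _ ≤ k ^ 2 * D := by
          rw [nsmul_eq_mul, Finset.card_product, sq]
          push_cast
          gcongr
  have h2 : ((((J ×ˢ T).filter fun w => w.1 ≠ w.2).biUnion (fun w => Finset.univ.filter fun e =>
      w.1 ∈ G.verts e ∧ w.2 ∈ G.verts e)).card : ℝ) ≤ k ^ 2 * D := by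
    calc _ ≤ ∑ w ∈ (J ×ˢ T).filter fun w => w.1 ≠ w.2, ((Finset.univ.filter fun e =>
            w.1 ∈ G.verts e ∧ w.2 ∈ G.verts e).card : ℝ) := by
          exact_mod_cast Finset.card_biUnion_le
      _ ≤ ((J ×ˢ T).filter fun w => w.1 ≠ w.2).card • D :=
          Finset.sum_le_card_nsmul _ _ _ fun w hw =>
            h.codegree_le w.1 w.2 (Finset.mem_filter.1 hw).2
      _ ≤ k ^ 2 * D := by
          have h3 := Finset.card_filter_le (J ×ˢ T) fun w => w.1 ≠ w.2
          rw [Finset.card_product] at h3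
          have h4 : (((J ×ˢ T).filter fun w => w.1 ≠ w.2).card : ℝ) ≤ J.card * T.card := by
            exact_mod_cast h3
          rw [nsmul_eq_mul, sq]
          refine mul_le_mul_of_nonneg_right (h4.trans ?_) hD
          gcongr
  have h3 := (Finset.card_le_card hsub).trans (Finset.card_union_le _ _)
  have h4 : ((neighbours (extendedColours G a) F
      ((S.disjSum T : Finset (𝒮 ⊕ V)) : Set (𝒮 ⊕ V))).card : ℝ) ≤ k ^ 2 * D + k ^ 2 * D :=
    (by exact_mod_cast h3 : _ ≤ (_ : ℝ)).trans ((Nat.cast_add _ _).trans_le (add_le_add h1 h2))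
  linarith

lemma card_neighbours_extendedColours_le (h : G.IsLinearType μ Z R m Δ k C c p D) (hD : 0 ≤ D)
    {Y : Finset X} {a b : X → V} {B : Finset V} (hO : G.IsOriented Y a b B) {F : Finset X}
    {J : Finset V} (hF : ∀ f ∈ F, f ∈ Y ∧ b f ∈ J) (hJ : J.card ≤ k) {g : X} (hg : g ∈ Y) :
    ((neighbours (extendedColours G a) F (extendedColours G a g)).card : ℝ) ≤ 2 * k ^ 2 * D := by
  refine card_neighbours_le h hD hO hF hJ (h.card_colours_le g) ?_
  rw [Finset.card_singleton]
  exact (Finset.card_pos.2 ⟨_, hO.tail_mem g hg⟩).trans_le (h.card_verts_le g)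

lemma card_filter_head_le (h : G.IsLinearType μ Z R m Δ k C c p D) (hΔ : 0 ≤ Δ) {Y : Finset X}
    {a b : X → V} {B : Finset V} (hO : G.IsOriented Y a b B) {J : Finset V} (hJ : J.card ≤ k) :
    ((Y.filter fun f => b f ∈ J).card : ℝ) ≤ k * Δ := by
  have hsub : (Y.filter fun f => b f ∈ J)
      ⊆ J.biUnion fun u => Finset.univ.filter fun e => u ∈ G.verts e := by
    intro f hf
    obtain ⟨hfY, hfJ⟩ := Finset.mem_filter.1 hf
    exact Finset.mem_biUnion.2
      ⟨b f, hfJ, Finset.mem_filter.2 ⟨Finset.mem_univ _, hO.head_mem f hfY⟩⟩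
  have h1 := (Finset.card_le_card hsub).trans Finset.card_biUnion_le
  calc ((Y.filter fun f => b f ∈ J).card : ℝ)
      ≤ ∑ u ∈ J, ((Finset.univ.filter fun e => u ∈ G.verts e).card : ℝ) := by exact_mod_cast h1
    _ ≤ J.card • Δ := Finset.sum_le_card_nsmul _ _ _ fun u _ => h.degree_le u
    _ ≤ k * Δ := by
        rw [nsmul_eq_mul]
        gcongr

end Setup

end ColouredHyperedges

/-! ### Covariances of the signed fluctuations -/

namespace ColouredHyperedges

open scoped Classical

section Terms

variable {V X 𝒮 Ω : Type*}

/-- The product of the random signs of the vertices in `T`. -/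
noncomputable def signProd (T : Finset V) (q : Ω × (V → Bool)) : ℝ :=
  ∏ v ∈ T, boolSign (q.2 v)

lemma abs_signProd (T : Finset V) (q : Ω × (V → Bool)) : |signProd T q| = 1 := by
  rw [signProd, Finset.abs_prod]
  exact Finset.prod_eq_one fun v _ => abs_boolSign _

/-- The mean sign of a vertex in the biased random `2`-cut: outside `B` a random sign, and on `B`
a slight bias against the current value of the block sum of the vertex. -/
noncomputable def meanSign (ξ : X → Ω × (V → Bool) → ℝ) (b : X → V) (Y : Finset X) (B : Finset V)
    (τ : ℝ) (q : Ω × (V → Bool)) (v : V) : ℝ :=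
  if v ∈ B then -τ * Real.sin (blockSum ξ b Y v q) else boolSign (q.2 v)

lemma abs_meanSign_le (ξ : X → Ω × (V → Bool) → ℝ) (b : X → V) (Y : Finset X) (B : Finset V)
    {τ : ℝ} (hτ0 : 0 ≤ τ) (hτ1 : τ ≤ 1) (q : Ω × (V → Bool)) (v : V) :
    |meanSign ξ b Y B τ q v| ≤ 1 := by
  unfold meanSign
  split_ifs
  · rw [abs_mul, abs_neg, abs_of_nonneg hτ0]
    exact mul_le_one₀ hτ1 (abs_nonneg _) (Real.abs_sin_le_one _)
  · exact (abs_boolSign _).le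

lemma prod_meanSign (ξ : X → Ω × (V → Bool) → ℝ) (b : X → V) (Y : Finset X) (B : Finset V)
    (τ : ℝ) (q : Ω × (V → Bool)) (T : Finset V) :
    ∏ v ∈ T, meanSign ξ b Y B τ q v
      = (-τ) ^ (T.filter (· ∈ B)).card * (signProd (T.filter (· ∉ B)) q
        * ∏ v ∈ T.filter (· ∈ B), Real.sin (blockSum ξ b Y v q)) := by
  rw [← Finset.prod_filter_mul_prod_filter_not T (· ∈ B), signProd]
  have h1 : ∏ v ∈ T.filter (· ∈ B), meanSign ξ b Y B τ q v
      = (-τ) ^ (T.filter (· ∈ B)).card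
        * ∏ v ∈ T.filter (· ∈ B), Real.sin (blockSum ξ b Y v q) := by
    rw [← Finset.prod_const, ← Finset.prod_mul_distrib]
    exact Finset.prod_congr rfl fun v hv => if_pos (Finset.mem_filter.1 hv).2
  have h2 : ∏ v ∈ T.filter (· ∉ B), meanSign ξ b Y B τ q v
      = ∏ v ∈ T.filter (· ∉ B), boolSign (q.2 v) :=
    Finset.prod_congr rfl fun v hv => if_neg (Finset.mem_filter.1 hv).2
  rw [h1, h2]
  ring

variable {β : 𝒮 → Type*} [∀ i, MeasurableSpace (β i)]

lemma measurable_signProd_colourSigma (Z : ∀ i, Ω → β i) {S : Set (𝒮 ⊕ V)} {T : Finset V}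
    (hT : ∀ v ∈ T, Sum.inr v ∈ S) :
    Measurable[colourSigma (jointColour V Z) S] fun q : Ω × (V → Bool) => signProd T q :=
  Finset.measurable_fun_prod T fun _ hv => measurable_boolSign_colourSigma Z (hT _ hv)

variable [MeasurableSpace Ω] [Fintype X]
  {G : ColouredHyperedges V X 𝒮} {μ : Measure Ω} {Z : ∀ i, Ω → β i}
  {R : Ω → Finset X} {m Δ : ℝ} {k : ℕ} {C c p D : ℝ}

/-- The pairs of hyperedges of `Y` with distinct heads in `e`, the same tail and a common colour.
Only these contribute to the correlation of the block sums of distinct vertices of `e`. -/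
noncomputable def correlatedPairs (G : ColouredHyperedges V X 𝒮) (Y : Finset X) (a b : X → V)
    (e : X) : Finset (X × X) :=
  (Y ×ˢ Y).filter fun w => (b w.1 ∈ G.verts e ∧ b w.2 ∈ G.verts e ∧ b w.1 ≠ b w.2) ∧
    (a w.1 = a w.2 ∧ ¬ Disjoint (G.colours w.1) (G.colours w.2))

lemma sum_card_correlatedPairs_le (h : G.IsLinearType μ Z R m Δ k C c p D) (hD : 0 ≤ D)
    {Y : Finset X} {a b : X → V} {B : Finset V} (hO : G.IsOriented Y a b B) :
    ∑ e, ((correlatedPairs G Y a b e).card : ℝ) ≤ Fintype.card X * (k * D ^ 2) := by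
  have h1 : ∀ e, ((correlatedPairs G Y a b e).card : ℝ) = ∑ f ∈ Y, ∑ g ∈ Y,
      if (b f ∈ G.verts e ∧ b g ∈ G.verts e ∧ b f ≠ b g) ∧
        (a f = a g ∧ ¬ Disjoint (G.colours f) (G.colours g)) then (1 : ℝ) else 0 := by
    intro e
    rw [correlatedPairs, ← Finset.sum_boole, Finset.sum_product]
  simp_rw [h1]
  rw [Finset.sum_comm]
  have h2 : ∀ f ∈ Y, ∑ e, ∑ g ∈ Y,
      (if (b f ∈ G.verts e ∧ b g ∈ G.verts e ∧ b f ≠ b g) ∧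
        (a f = a g ∧ ¬ Disjoint (G.colours f) (G.colours g)) then (1 : ℝ) else 0)
      ≤ k * D ^ 2 := by
    intro f hf
    rw [Finset.sum_comm]
    have h3 : ∀ g ∈ Y, ∑ e,
        (if (b f ∈ G.verts e ∧ b g ∈ G.verts e ∧ b f ≠ b g) ∧
          (a f = a g ∧ ¬ Disjoint (G.colours f) (G.colours g)) then (1 : ℝ) else 0)
        ≤ D * if a f = a g ∧ ¬ Disjoint (G.colours f) (G.colours g) then 1 else 0 := by
      intro g _
      by_cases hfg : a f = a g ∧ ¬ Disjoint (G.colours f) (G.colours g)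
      · by_cases hb : b f = b g
        · simp only [hb, ne_eq, not_true_eq_false, and_false, false_and, if_false,
            Finset.sum_const_zero]
          positivity
        · rw [if_pos hfg, mul_one]
          refine le_trans (le_of_eq ?_) (h.codegree_le (b f) (b g) hb)
          rw [Finset.sum_boole]
          simp only [hfg, hb, ne_eq, not_false_eq_true, and_true]
      · simp only [hfg, and_false, if_false, Finset.sum_const_zero, mul_zero, le_refl]
    refine (Finset.sum_le_sum h3).trans ?_
    rw [← Finset.mul_sum, Finset.sum_boole]
    have h4 : (Y.filter fun g => a f = a g ∧ ¬ Disjoint (G.colours f) (G.colours g))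
        ⊆ (G.colours f).biUnion fun i =>
          Finset.univ.filter fun e => a f ∈ G.verts e ∧ i ∈ G.colours e := by
      intro g hg
      obtain ⟨hgY, hag, hd⟩ := Finset.mem_filter.1 hg
      obtain ⟨i, hi, hi'⟩ := Finset.not_disjoint_iff.1 hd
      exact Finset.mem_biUnion.2 ⟨i, hi, Finset.mem_filter.2
        ⟨Finset.mem_univ _, hag ▸ hO.tail_mem g hgY, hi'⟩⟩
    have h5 := (Finset.card_le_card h4).trans Finset.card_biUnion_le
    have h6 : ((Y.filter fun g => a f = a g ∧ ¬ Disjoint (G.colours f) (G.colours g)).card : ℝ)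
        ≤ k * D := by
      calc _ ≤ ∑ i ∈ G.colours f, ((Finset.univ.filter fun e =>
              a f ∈ G.verts e ∧ i ∈ G.colours e).card : ℝ) := by exact_mod_cast h5
        _ ≤ (G.colours f).card • D :=
            Finset.sum_le_card_nsmul _ _ _ fun i _ => h.colour_codegree_le (a f) i
        _ ≤ k * D := by
            rw [nsmul_eq_mul]
            have := h.card_colours_le f
            gcongr
    calc _ ≤ D * (k * D) := by gcongr
      _ = k * D ^ 2 := by ring
  refine (Finset.sum_le_sum h2).trans ?_
  rw [Finset.sum_const, nsmul_eq_mul]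
  have := Finset.card_le_univ Y
  gcongr

variable [Fintype V] [IsProbabilityMeasure μ]

lemma integral_mul_signProd_eq_zero (h : G.IsLinearType μ Z R m Δ k C c p D) {T : Finset V}
    {v : V} (hv : v ∈ T) {Q : Ω × (V → Bool) → ℝ}
    (hQ : Measurable[colourSigma (jointColour V Z) {Sum.inr v}ᶜ] Q) :
    ∫ q, Q q * signProd T q ∂μ.prod (signMeasure V) = 0 := by
  have h1 : ∀ q : Ω × (V → Bool),
      Q q * signProd T q = Q q * signProd (T.erase v) q * boolSign (q.2 v) := by
    intro q
    rw [mul_assoc, signProd, signProd, Finset.prod_erase_mul _ _ hv]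
  simp_rw [h1]
  refine integral_mul_boolSign_eq_zero h.measurable_colour h.indep (S := {Sum.inr v}ᶜ)
    (by simp) (hQ.mul (measurable_signProd_colourSigma Z fun u hu => ?_))
  simpa using (Finset.mem_erase.1 hu).1

lemma integral_signedFluctuation (h : G.IsLinearType μ Z R m Δ k C c p D) (a : X → V) (δ : ℝ)
    (f : X) : ∫ q, signedFluctuation μ R a δ f q ∂μ.prod (signMeasure V) = 0 := by
  unfold signedFluctuation
  rw [integral_const_mul, integral_mul_boolSign_eq_zero h.measurable_colour h.indep
    (S := {Sum.inr (a f)}ᶜ) (by simp)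
    ((measurable_edgeInd_colourSigma h fun i _ => by simp).sub_const _), mul_zero]

lemma integral_edgeInd_mul_sub (h : G.IsLinearType μ Z R m Δ k C c p D) (e f : X) :
    ∫ q : Ω × (V → Bool), edgeInd R e q.1 * (edgeInd R f q.1 - μ.real {ω | f ∈ R ω})
        ∂μ.prod (signMeasure V)
      = μ.real {ω | e ∈ R ω ∧ f ∈ R ω} - μ.real {ω | e ∈ R ω} * μ.real {ω | f ∈ R ω} := by
  have hi : ∀ e, Integrable (edgeInd R e) μ := fun e =>
    integrable_of_norm_le (C := 1) (measurable_edgeInd h e) fun ω => by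
      rw [Real.norm_eq_abs, abs_of_nonneg (edgeInd_nonneg R e ω)]; exact edgeInd_le_one R e ω
  have hi2 : Integrable (fun ω => edgeInd R e ω * edgeInd R f ω) μ :=
    integrable_of_norm_le (C := 1) ((measurable_edgeInd h e).mul (measurable_edgeInd h f))
      fun ω => by
        rw [edgeInd_mul]; split_ifs <;> simp
  rw [integral_fun_fst fun ω => edgeInd R e ω * (edgeInd R f ω - μ.real {ω | f ∈ R ω})]
  simp_rw [mul_sub]
  rw [integral_sub hi2 ((hi e).mul_const _), integral_edgeInd_mul h, integral_mul_const,
    integral_edgeInd h]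
  simp

lemma integral_signProd_mul_signedFluctuation_self (h : G.IsLinearType μ Z R m Δ k C c p D)
    (a : X → V) (δ : ℝ) (e f : X) :
    ∫ q, edgeInd R e q.1 * signProd {a f} q * signedFluctuation μ R a δ f q
        ∂μ.prod (signMeasure V)
      = δ * (μ.real {ω | e ∈ R ω ∧ f ∈ R ω} - μ.real {ω | e ∈ R ω} * μ.real {ω | f ∈ R ω}) := by
  rw [← integral_edgeInd_mul_sub (V := V) h, ← integral_const_mul]
  refine integral_congr_ae (ae_of_all _ fun q => ?_)
  have := boolSign_mul_self (q.2 (a f))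
  simp only [signProd, signedFluctuation, Finset.prod_singleton]
  linear_combination
    (edgeInd R e q.1 * δ * (edgeInd R f q.1 - μ.real {ω | f ∈ R ω})) * this

/-- The random signs kill all covariances except for those that are nonnegative by assumption. -/
lemma integral_signProd_mul_signedFluctuation_nonneg (h : G.IsLinearType μ Z R m Δ k C c p D)
    (a : X → V) {δ : ℝ} (hδ : 0 ≤ δ) (e f : X) {T : Finset V} (hT : T.Nonempty) :
    0 ≤ ∫ q, edgeInd R e q.1 * signProd T q * signedFluctuation μ R a δ f q
        ∂μ.prod (signMeasure V) := by
  by_cases hTa : T = {a f}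
  · rw [hTa, integral_signProd_mul_signedFluctuation_self h]
    exact mul_nonneg hδ (sub_nonneg.2 (h.correlation e f))
  · obtain ⟨v, hv, hva⟩ : ∃ v ∈ T, v ≠ a f := by
      by_contra! hcon
      exact hTa (Finset.eq_singleton_iff_nonempty_unique_mem.2 ⟨hT, hcon⟩)
    have h1 : Measurable[colourSigma (jointColour V Z) {Sum.inr v}ᶜ] fun q : Ω × (V → Bool) =>
        edgeInd R e q.1 * signedFluctuation μ R a δ f q := by
      refine (measurable_edgeInd_colourSigma h fun i _ => by simp).mul
        ((measurable_signedFluctuation h a δ f).mono (colourSigma_mono _ ?_) le_rfl)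
      rintro x hx rfl
      simp only [extendedColours, Finset.mem_coe, Finset.inr_mem_disjSum,
        Finset.mem_singleton] at hx
      exact hva hx
    have h2 := integral_mul_signProd_eq_zero (μ := μ) h hv h1
    refine le_of_eq (h2.symm.trans (integral_congr_ae (ae_of_all _ fun q => ?_)))
    simp only
    ring

/-- Signed fluctuations of two hyperedges are uncorrelated, by the random signs unless the tails
agree, and by the independence of the colour variables unless a colour is shared. -/
lemma abs_integral_signedFluctuation_mul_le (h : G.IsLinearType μ Z R m Δ k C c p D)
    (a : X → V) {δ : ℝ} (hδ : 0 ≤ δ) (f g : X) :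
    |∫ q, signedFluctuation μ R a δ f q * signedFluctuation μ R a δ g q
        ∂μ.prod (signMeasure V)|
      ≤ δ ^ 2 * if a f = a g ∧ ¬ Disjoint (G.colours f) (G.colours g) then 1 else 0 := by
  split_ifs with hfg
  · rw [mul_one, sq, ← Real.norm_eq_abs]
    refine norm_integral_le_of_forall_norm_le fun q => ?_
    rw [norm_mul]
    exact mul_le_mul (abs_signedFluctuation_le a hδ f q) (abs_signedFluctuation_le a hδ g q)
      (norm_nonneg _) hδ
  · rw [mul_zero, abs_nonpos_iff]
    by_cases ha : a f = a g
    · have hd : Disjoint (G.colours f) (G.colours g) := by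
        by_contra hd
        exact hfg ⟨ha, hd⟩
      set S : Set (𝒮 ⊕ V) := Sum.inl '' (G.colours f : Set 𝒮) with hS
      have h1 : Measurable[colourSigma (jointColour V Z) S] fun q : Ω × (V → Bool) =>
          edgeInd R f q.1 - μ.real {ω | f ∈ R ω} :=
        (measurable_edgeInd_colourSigma h fun i hi => Set.mem_image_of_mem _ hi).sub_const _
      have hsign : ∀ v : V, Measurable[colourSigma (jointColour V Z) Sᶜ]
          fun q : Ω × (V → Bool) => boolSign (q.2 v) := fun v =>
        measurable_boolSign_colourSigma Z (by simp [hS])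
      have h2 : Measurable[colourSigma (jointColour V Z) Sᶜ] fun q : Ω × (V → Bool) =>
          δ ^ 2 * (boolSign (q.2 (a f)) *
            ((edgeInd R g q.1 - μ.real {ω | g ∈ R ω}) * boolSign (q.2 (a g)))) := by
        refine ((hsign _).mul (((measurable_edgeInd_colourSigma h fun i hi => ?_).sub_const
          _).mul (hsign _))).const_mul _
        rintro ⟨j, hj, hji⟩
        rw [Sum.inl.inj hji] at hj
        exact Finset.disjoint_left.1 hd hj hi
      have h3 := integral_mul_of_disjoint_colours (jointColour_le h.measurable_colour)
        (iIndep_jointColour h.indep) (disjoint_compl_right (a := S)) h1 h2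
      have h4 : ∫ q : Ω × (V → Bool), (edgeInd R f q.1 - μ.real {ω | f ∈ R ω})
          ∂μ.prod (signMeasure V) = 0 := by
        rw [integral_fun_fst fun ω => edgeInd R f ω - μ.real {ω | f ∈ R ω},
          integral_sub (integrable_of_norm_le (C := 1) (measurable_edgeInd h f) fun ω => by
            rw [Real.norm_eq_abs, abs_of_nonneg (edgeInd_nonneg R f ω)]
            exact edgeInd_le_one R f ω) (integrable_const _), integral_edgeInd h]
        simp
      rw [h4, zero_mul] at h3
      rw [← h3]
      refine integral_congr_ae (ae_of_all _ fun q => ?_)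
      simp only [signedFluctuation]
      ring
    · have h1 : Measurable[colourSigma (jointColour V Z) {Sum.inr (a g)}ᶜ]
          fun q : Ω × (V → Bool) => δ * (signedFluctuation μ R a δ f q *
            (edgeInd R g q.1 - μ.real {ω | g ∈ R ω})) := by
        refine (((measurable_signedFluctuation h a δ f).mono (colourSigma_mono _ ?_)
          le_rfl).mul
          ((measurable_edgeInd_colourSigma h fun i _ => by simp).sub_const _)).const_mul _
        rintro x hx rfl
        simp only [extendedColours, Finset.mem_coe, Finset.inr_mem_disjSum,
          Finset.mem_singleton] at hx
        exact ha hx.symm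
      have h2 := integral_mul_boolSign_eq_zero (μ := μ) h.measurable_colour h.indep
        (v := a g) (by simp) h1
      rw [← h2]
      refine integral_congr_ae (ae_of_all _ fun q => ?_)
      simp only [signedFluctuation]
      ring

lemma sum_abs_integral_le_correlatedPairs (h : G.IsLinearType μ Z R m Δ k C c p D)
    {Y : Finset X} {a b : X → V} {δ : ℝ} (hδ : 0 ≤ δ) {e : X} {J : Finset V}
    (hJ : J ⊆ G.verts e) :
    (∑ f ∈ Y with b f ∈ J, ∑ g ∈ Y with b g ∈ J, if b f = b g then 0 else
        |∫ q, signedFluctuation μ R a δ f q * signedFluctuation μ R a δ g q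
          ∂μ.prod (signMeasure V)|)
      ≤ δ ^ 2 * (correlatedPairs G Y a b e).card := by
  rw [correlatedPairs, ← Finset.sum_boole, Finset.sum_product, Finset.mul_sum, Finset.sum_filter]
  refine Finset.sum_le_sum fun f _ => ?_
  by_cases hf : b f ∈ J
  · rw [if_pos hf, Finset.mul_sum, Finset.sum_filter]
    refine Finset.sum_le_sum fun g _ => ?_
    by_cases hg : b g ∈ J
    · rw [if_pos hg]
      by_cases hb : b f = b g
      · rw [if_pos hb]
        positivity
      · rw [if_neg hb]
        simpa only [hJ hf, hJ hg, hb, ne_eq, not_false_eq_true, and_true, true_and]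
          using abs_integral_signedFluctuation_mul_le h a hδ f g
    · rw [if_neg hg]
      positivity
  · rw [if_neg hf]
    positivity

end Terms

end ColouredHyperedges

/-! ### Gain and loss of a single monomial -/

namespace ColouredHyperedges

open scoped Classical

section Surplus

variable {V X 𝒮 Ω : Type*}

lemma abs_edgeInd_mul_signProd_le (R : Ω → Finset X) (e : X) (T : Finset V)
    (q : Ω × (V → Bool)) : |edgeInd R e q.1 * signProd T q| ≤ 1 := by
  rw [abs_mul, abs_signProd, mul_one, abs_of_nonneg (edgeInd_nonneg R e q.1)]
  exact edgeInd_le_one R e q.1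

variable [MeasurableSpace Ω] {β : 𝒮 → Type*} [∀ i, MeasurableSpace (β i)] [Fintype X]
  {G : ColouredHyperedges V X 𝒮} {μ : Measure Ω} {Z : ∀ i, Ω → β i}
  {R : Ω → Finset X} {m Δ : ℝ} {k : ℕ} {C c p D : ℝ} {Y : Finset X} {a b : X → V} {B : Finset V}

lemma measurable_edgeInd_mul_signProd (h : G.IsLinearType μ Z R m Δ k C c p D) (e : X)
    (T : Finset V) :
    Measurable[colourSigma (jointColour V Z) (((G.colours e).disjSum T : Finset (𝒮 ⊕ V)))]
      fun q : Ω × (V → Bool) => edgeInd R e q.1 * signProd T q :=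
  (measurable_edgeInd_colourSigma h fun i hi => by simpa using hi).mul
    (measurable_signProd_colourSigma Z fun v hv => by simpa using hv)

lemma measurable_blockSum (h : G.IsLinearType μ Z R m Δ k C c p D) (a b : X → V) (δ : ℝ)
    (Y : Finset X) (v : V) :
    Measurable (blockSum (signedFluctuation μ R a δ) b Y v) :=
  Finset.measurable_fun_sum _ fun f _ =>
    (measurable_signedFluctuation h a δ f).mono (colourSigma_le (jointColour_le
      h.measurable_colour) _) le_rfl

variable [Fintype V] [IsProbabilityMeasure μ]

lemma integral_edgeInd_mul_signProd (h : G.IsLinearType μ Z R m Δ k C c p D) (e : X)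
    {T : Finset V} (hT : T.Nonempty) :
    ∫ q, edgeInd R e q.1 * signProd T q ∂μ.prod (signMeasure V) = 0 := by
  obtain ⟨v, hv⟩ := hT
  exact integral_mul_signProd_eq_zero h hv (measurable_edgeInd_colourSigma h fun i _ => by simp)

/-- The gain: a monomial with exactly one vertex `u` of `B` correlates with the sine of the block
sum of `u`, because the hyperedge `e` contributes its own variance to this correlation and every
other hyperedge contributes a nonnegative amount. -/
lemma gain_le_integral_mul_sin (h : G.IsLinearType μ Z R m Δ k C c p D) (hD : 0 ≤ D)
    (hO : G.IsOriented Y a b B) {δ : ℝ} (hδ : 0 ≤ δ)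
    (hvar : Δ * (2 * k ^ 2 * D) * δ ^ 2 ≤ 1) (e : X) {T : Finset V} (hT : T.Nonempty)
    (hTk : T.card ≤ k) (u : V) :
    (if e ∈ Y ∧ b e = u ∧ T = {a e} then
        δ * (μ.real {ω | e ∈ R ω} - μ.real {ω | e ∈ R ω} ^ 2) / 2 else 0)
        - 4 * (2 * k ^ 2 * D) ^ 2 * δ ^ 2
      ≤ ∫ q, edgeInd R e q.1 * signProd T q *
        Real.sin (blockSum (signedFluctuation μ R a δ) b Y u q) ∂μ.prod (signMeasure V) := by
  have hm := jointColour_le (V := V) h.measurable_colour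
  have hind := iIndep_jointColour (V := V) h.indep
  have hξm := measurable_signedFluctuation h a δ
  have hξM := fun f => (hξm f).mono (colourSigma_le hm _) le_rfl
  have hξ := abs_signedFluctuation_le (μ := μ) (R := R) a hδ
  have hQm := measurable_edgeInd_mul_signProd h e T
  have hQM := hQm.mono (colourSigma_le hm _) le_rfl
  have hQ := abs_edgeInd_mul_signProd_le R e T
  have hk1 : 1 ≤ k := (Nat.succ_le_of_lt hT.card_pos).trans hTk
  set F := Y.filter fun f => b f = u with hF
  have hFJ : ∀ f ∈ F, f ∈ Y ∧ b f ∈ ({u} : Finset V) := fun f hf => by simpa [hF] using hf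
  have hN : ∀ g ∈ F, ((neighbours (extendedColours G a) F (extendedColours G a g)).card : ℝ)
      ≤ 2 * k ^ 2 * D := fun g hg =>
    card_neighbours_extendedColours_le h hD hO hFJ (by simpa using hk1) (Finset.mem_filter.1 hg).1
  have hNQ := card_neighbours_le h hD hO hFJ (by simpa using hk1) (h.card_colours_le e) hTk
  have hFcard : (F.card : ℝ) ≤ Δ := by
    refine le_trans ?_ (h.degree_le u)
    refine Nat.cast_le.2 (Finset.card_le_card fun f hf => ?_)
    obtain ⟨hfY, hfu⟩ := Finset.mem_filter.1 hf
    exact Finset.mem_filter.2 ⟨Finset.mem_univ _, hfu ▸ hO.head_mem f hfY⟩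
  have hvar' := integral_sum_sq_le hm hind hξm hξ hδ (integral_signedFluctuation h a δ) F hN
  have hvar1 : ∫ q, (∑ g ∈ F, signedFluctuation μ R a δ g q) ^ 2 ∂μ.prod (signMeasure V) ≤ 1 := by
    refine hvar'.trans (le_trans ?_ hvar)
    gcongr
  have hcov : ∫ q, edgeInd R e q.1 * signProd T q * ∑ g ∈ F, signedFluctuation μ R a δ g q
        ∂μ.prod (signMeasure V)
      = ∑ g ∈ F, ∫ q, edgeInd R e q.1 * signProd T q * signedFluctuation μ R a δ g q
        ∂μ.prod (signMeasure V) := by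
    simp_rw [Finset.mul_sum]
    refine integral_finsetSum _ fun g _ => ?_
    refine integrable_of_norm_le (C := 1 * δ) (hQM.mul (hξM g)) fun q => ?_
    rw [norm_mul]
    exact mul_le_mul (hQ q) (hξ g q) (norm_nonneg _) zero_le_one
  have hterm := fun g => integral_signProd_mul_signedFluctuation_nonneg h a hδ e g hT
  have hpos : 0 ≤ ∫ q, edgeInd R e q.1 * signProd T q * ∑ g ∈ F, signedFluctuation μ R a δ g q
      ∂μ.prod (signMeasure V) := by
    rw [hcov]
    exact Finset.sum_nonneg fun g _ => hterm g
  have hmain := half_integral_mul_sum_sub_le hm hind hξm hξ F hQm hQ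
    (integral_edgeInd_mul_signProd h e hT) hNQ hN hpos hvar1
  refine le_trans (sub_le_sub_right ?_ _) hmain
  split_ifs with he
  · obtain ⟨heY, hbe, hTe⟩ := he
    have heF : e ∈ F := Finset.mem_filter.2 ⟨heY, hbe⟩
    have h1 := Finset.single_le_sum (fun g _ => hterm g) heF
    rw [← hcov, hTe, integral_signProd_mul_signedFluctuation_self h] at h1
    simp only [and_self, ← sq] at h1
    rw [hTe]
    linarith
  · linarith

/-- The loss: a monomial with vertices `J` in `B` and `T` outside `B`. If `T` is nonempty, it is
centred; otherwise the block sums of the vertices of `J` are nearly independent. -/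
lemma abs_integral_mul_prod_sin_blockSum_le (h : G.IsLinearType μ Z R m Δ k C c p D) (hD : 0 ≤ D)
    (hΔ : 0 ≤ Δ) (hO : G.IsOriented Y a b B) {δ : ℝ} (hδ : 0 ≤ δ) (e : X) {T J : Finset V}
    (hTk : T.card ≤ k) (hJ : J.Nonempty) (hJe : J ⊆ G.verts e) :
    |∫ q, edgeInd R e q.1 * signProd T q *
        ∏ v ∈ J, Real.sin (blockSum (signedFluctuation μ R a δ) b Y v q) ∂μ.prod (signMeasure V)|
      ≤ 2 * k ^ 2 * D * δ + 4 * (2 * k ^ 2 * D) ^ 2 * δ ^ 2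
        + (4 * (k * Δ) * (2 * k ^ 2 * D) ^ 2 * δ ^ 3
          + δ ^ 2 * (correlatedPairs G Y a b e).card / 2) := by
  have hm := jointColour_le (V := V) h.measurable_colour
  have hind := iIndep_jointColour (V := V) h.indep
  have hξm := measurable_signedFluctuation h a δ
  have hξ := abs_signedFluctuation_le (μ := μ) (R := R) a hδ
  have hJk : J.card ≤ k := (Finset.card_le_card hJe).trans (h.card_verts_le e)
  have hF : ∀ f ∈ Y.filter fun f => b f ∈ J, f ∈ Y ∧ b f ∈ J := fun f hf => Finset.mem_filter.1 hf
  have hN : ∀ g ∈ Y, b g ∈ J → ((neighbours (extendedColours G a) (Y.filter fun f => b f ∈ J)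
      (extendedColours G a g)).card : ℝ) ≤ 2 * k ^ 2 * D := fun g hg _ =>
    card_neighbours_extendedColours_le h hD hO hF hJk hg
  have hNQ := fun T (hTk : T.card ≤ k) =>
    card_neighbours_le h hD hO hF hJk (h.card_colours_le e) (T := T) hTk
  rcases T.eq_empty_or_nonempty with rfl | hT
  · set P := μ.real {ω | e ∈ R ω} with hP
    have hP0 : 0 ≤ P := measureReal_nonneg
    have hP1 : P ≤ 1 := measureReal_le_one
    have hc : ∫ q : Ω × (V → Bool), (edgeInd R e q.1 - P) ∂μ.prod (signMeasure V) = 0 := by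
      rw [integral_fun_fst fun ω => edgeInd R e ω - P,
        integral_sub (integrable_of_norm_le (C := 1) (measurable_edgeInd h e) fun ω => by
          rw [Real.norm_eq_abs, abs_of_nonneg (edgeInd_nonneg R e ω)]
          exact edgeInd_le_one R e ω) (integrable_const _), integral_edgeInd h]
      simp [hP]
    have hcm : Measurable[colourSigma (jointColour V Z)
        (((G.colours e).disjSum ∅ : Finset (𝒮 ⊕ V)))]
        fun q : Ω × (V → Bool) => edgeInd R e q.1 - P :=
      (measurable_edgeInd_colourSigma h fun i hi => by simpa using hi).sub_const _
    have h1 := abs_integral_centred_mul_prod_sin_le hm hind b hξm hξ hδ Y hJ hcm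
      (fun q => abs_edgeInd_sub_le e q.1) hc (hNQ ∅ (by simp)) hN
    have h2 := abs_integral_prod_sin_le hm hind b hξm hξ hδ (integral_signedFluctuation h a δ)
      Y hJ hN
    have h3 := sum_abs_integral_le_correlatedPairs (μ := μ) h (Y := Y) (a := a) (b := b) hδ hJe
    have h4 := card_filter_head_le h hΔ hO hJk
    have hsM : Measurable fun q : Ω × (V → Bool) =>
        ∏ v ∈ J, Real.sin (blockSum (signedFluctuation μ R a δ) b Y v q) :=
      Finset.measurable_fun_prod J fun v _ =>
        Real.measurable_sin.comp (measurable_blockSum h a b δ Y v)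
    have hs1 : ∀ q : Ω × (V → Bool),
        |∏ v ∈ J, Real.sin (blockSum (signedFluctuation μ R a δ) b Y v q)| ≤ 1 := fun q => by
      rw [Finset.abs_prod]
      exact Finset.prod_le_one (fun _ _ => abs_nonneg _) fun _ _ => Real.abs_sin_le_one _
    have hi1 : Integrable (fun q : Ω × (V → Bool) => (edgeInd R e q.1 - P) *
        ∏ v ∈ J, Real.sin (blockSum (signedFluctuation μ R a δ) b Y v q))
        (μ.prod (signMeasure V)) :=
      integrable_of_norm_le (C := 1 * 1)
        ((hcm.mono (colourSigma_le hm _) le_rfl).mul hsM) fun q => by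
          rw [norm_mul]
          exact mul_le_mul (abs_edgeInd_sub_le e q.1) (hs1 q) (norm_nonneg _) zero_le_one
    have hi2 : Integrable (fun q : Ω × (V → Bool) =>
        P * ∏ v ∈ J, Real.sin (blockSum (signedFluctuation μ R a δ) b Y v q))
        (μ.prod (signMeasure V)) :=
      (integrable_of_norm_le hsM hs1).const_mul _
    have hsplit : ∫ q, edgeInd R e q.1 * signProd ∅ q *
        ∏ v ∈ J, Real.sin (blockSum (signedFluctuation μ R a δ) b Y v q) ∂μ.prod (signMeasure V)
        = (∫ q, (edgeInd R e q.1 - P) *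
          ∏ v ∈ J, Real.sin (blockSum (signedFluctuation μ R a δ) b Y v q)
            ∂μ.prod (signMeasure V))
          + P * ∫ q, ∏ v ∈ J, Real.sin (blockSum (signedFluctuation μ R a δ) b Y v q)
            ∂μ.prod (signMeasure V) := by
      rw [← integral_const_mul, ← integral_add hi1 hi2]
      refine integral_congr_ae (ae_of_all _ fun q => ?_)
      simp only [signProd, Finset.prod_empty]
      ring
    rw [hsplit]
    refine (abs_add_le _ _).trans (add_le_add h1 ?_)
    rw [abs_mul, abs_of_nonneg hP0]
    refine (mul_le_of_le_one_left (abs_nonneg _) hP1).trans (h2.trans (add_le_add ?_ ?_))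
    · gcongr
    · linarith
  · refine (abs_integral_centred_mul_prod_sin_le hm hind b hξm hξ hδ Y hJ
      (measurable_edgeInd_mul_signProd h e T) (abs_edgeInd_mul_signProd_le R e T)
      (integral_edgeInd_mul_signProd h e hT) (hNQ T hTk) hN).trans ?_
    have : 0 ≤ 4 * (k * Δ) * (2 * k ^ 2 * D) ^ 2 * δ ^ 3
          + δ ^ 2 * (correlatedPairs G Y a b e).card / 2 := by positivity
    linarith

/-- The contribution of a single monomial to the expected surplus. -/
lemma cutCoeff_mul_integral_le (h : G.IsLinearType μ Z R m Δ k C c p D) (hD : 0 ≤ D)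
    (hΔ : 0 ≤ Δ) (hO : G.IsOriented Y a b B) {δ τ : ℝ} (hδ : 0 ≤ δ)
    (hvar : Δ * (2 * k ^ 2 * D) * δ ^ 2 ≤ 1) (hτ0 : 0 ≤ τ) (hτ1 : τ ≤ 1) (e : X) {T : Finset V}
    (hT : T.Nonempty) (hTe : T ⊆ G.verts e) :
    Multihypergraph.cutCoeff (G.verts e) T * ∫ q, edgeInd R e q.1 *
        ∏ v ∈ T, meanSign (signedFluctuation μ R a δ) b Y B τ q v ∂μ.prod (signMeasure V)
      ≤ Multihypergraph.cutCoeff (G.verts e) T *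
        (τ * (4 * (2 * k ^ 2 * D) ^ 2 * δ ^ 2)
          + τ ^ 2 * (2 * k ^ 2 * D * δ + 4 * (2 * k ^ 2 * D) ^ 2 * δ ^ 2
            + (4 * (k * Δ) * (2 * k ^ 2 * D) ^ 2 * δ ^ 3
              + δ ^ 2 * (correlatedPairs G Y a b e).card / 2))
          - if e ∈ Y ∧ T = {a e, b e} then
              τ * (δ * (μ.real {ω | e ∈ R ω} - μ.real {ω | e ∈ R ω} ^ 2) / 2) else 0) := by
  set J := T.filter (· ∈ B) with hJ
  set T' := T.filter (· ∉ B) with hT'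
  set L := 2 * k ^ 2 * D * δ + 4 * (2 * k ^ 2 * D) ^ 2 * δ ^ 2
            + (4 * (k * Δ) * (2 * k ^ 2 * D) ^ 2 * δ ^ 3
              + δ ^ 2 * (correlatedPairs G Y a b e).card / 2) with hL
  have hL0 : 0 ≤ L := by positivity
  have hTk : T.card ≤ k := (Finset.card_le_card hTe).trans (h.card_verts_le e)
  have hT'k : T'.card ≤ k := (Finset.card_le_card (Finset.filter_subset _ _)).trans hTk
  have hJe : J ⊆ G.verts e := (Finset.filter_subset _ _).trans hTe
  have hrw : ∫ q, edgeInd R e q.1 *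
        ∏ v ∈ T, meanSign (signedFluctuation μ R a δ) b Y B τ q v ∂μ.prod (signMeasure V)
      = (-τ) ^ J.card * ∫ q, edgeInd R e q.1 * signProd T' q *
        ∏ v ∈ J, Real.sin (blockSum (signedFluctuation μ R a δ) b Y v q)
          ∂μ.prod (signMeasure V) := by
    rw [← integral_const_mul]
    refine integral_congr_ae (ae_of_all _ fun q => ?_)
    simp only [prod_meanSign]
    rw [← hJ, ← hT']
    ring
  rw [hrw]
  -- the distinguished pair of `e` has exactly one vertex in `B`
  have hpair : e ∈ Y ∧ T = {a e, b e} → J = {b e} ∧ T' = {a e} := by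
    rintro ⟨heY, rfl⟩
    have ha := hO.tail_notMem e heY
    have hb := hO.head_mem_part e heY
    constructor
    · rw [hJ, Finset.filter_insert, if_neg ha, Finset.filter_singleton, if_pos hb]
    · rw [hT', Finset.filter_insert, if_pos ha, Finset.filter_singleton, if_neg (not_not.2 hb)]
      rfl
  have hcoeff := Multihypergraph.cutCoeff_nonneg (G.verts e) T
  rcases Nat.lt_trichotomy J.card 1 with hJ1 | hJ1 | hJ1
  · have hJ0 : J = ∅ := Finset.card_eq_zero.1 (by omega)
    have hif : ¬ (e ∈ Y ∧ T = {a e, b e}) := fun hp => by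
      have := (hpair hp).1
      rw [hJ0] at this
      exact Finset.singleton_ne_empty _ this.symm
    have hT'ne : T'.Nonempty := by
      obtain ⟨v, hv⟩ := hT
      refine ⟨v, Finset.mem_filter.2 ⟨hv, fun hvB => ?_⟩⟩
      have : v ∈ J := Finset.mem_filter.2 ⟨hv, hvB⟩
      rw [hJ0] at this
      exact absurd this (Finset.notMem_empty v)
    rw [if_neg hif, hJ0]
    simp only [Finset.card_empty, pow_zero, one_mul, Finset.prod_empty, mul_one, sub_zero]
    rw [integral_edgeInd_mul_signProd h e hT'ne, mul_zero]
    positivity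
  · obtain ⟨u, hu⟩ := Finset.card_eq_one.1 hJ1
    rcases T'.eq_empty_or_nonempty with hT'0 | hT'ne
    · -- the monomial is a single vertex, which has odd cardinality
      have hodd : Odd T.card := by
        have := Finset.card_filter_add_card_filter_not (s := T) (p := (· ∈ B))
        rw [← hJ, ← hT', hT'0, hJ1] at this
        exact ⟨0, by simpa using this.symm⟩
      rw [Multihypergraph.cutCoeff_of_odd _ hodd, zero_mul, zero_mul]
    · refine mul_le_mul_of_nonneg_left ?_ hcoeff
      have hgain := gain_le_integral_mul_sin h hD hO hδ hvar e hT'ne hT'k u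
      rw [hu, Finset.card_singleton, pow_one]
      simp only [Finset.prod_singleton]
      set A := ∫ q, edgeInd R e q.1 * signProd T' q *
        Real.sin (blockSum (signedFluctuation μ R a δ) b Y u q) ∂μ.prod (signMeasure V)
      have hτL : 0 ≤ τ ^ 2 * L := by positivity
      split_ifs with hp
      · have hp' := hpair hp
        have hbu : b e = u := by
          have := hp'.1
          rw [hu] at this
          exact (Finset.singleton_injective this).symm
        rw [if_pos ⟨hp.1, hbu, hp'.2⟩] at hgain
        have := mul_le_mul_of_nonneg_left hgain hτ0
        linarith
      · have h1 : -(4 * (2 * k ^ 2 * D) ^ 2 * δ ^ 2) ≤ A := by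
          refine le_trans ?_ hgain
          have h2 : 0 ≤ μ.real {ω | e ∈ R ω} - μ.real {ω | e ∈ R ω} ^ 2 := by
            have h3 : 0 ≤ μ.real {ω | e ∈ R ω} := measureReal_nonneg
            have h4 : μ.real {ω | e ∈ R ω} ≤ 1 := measureReal_le_one
            nlinarith
          have h5 : 0 ≤ (if e ∈ Y ∧ b e = u ∧ T' = {a e} then
              δ * (μ.real {ω | e ∈ R ω} - μ.real {ω | e ∈ R ω} ^ 2) / 2 else 0) := by
            split_ifs <;> positivity
          linarith
        have := mul_le_mul_of_nonneg_left h1 hτ0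
        linarith
  · have hif : ¬ (e ∈ Y ∧ T = {a e, b e}) := fun hp => by
      rw [(hpair hp).1, Finset.card_singleton] at hJ1
      exact lt_irrefl _ hJ1
    rw [if_neg hif, sub_zero]
    refine mul_le_mul_of_nonneg_left ?_ hcoeff
    have hloss := abs_integral_mul_prod_sin_blockSum_le h hD hΔ hO hδ e hT'k
      (Finset.card_pos.1 (by omega)) hJe
    rw [← hL] at hloss
    refine (le_abs_self _).trans ?_
    rw [abs_mul, abs_pow, abs_neg, abs_of_nonneg hτ0]
    have hpow : τ ^ J.card ≤ τ ^ 2 := pow_le_pow_of_le_one hτ0 hτ1 hJ1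
    have h1 := mul_le_mul hpow hloss (abs_nonneg _) (by positivity)
    have h2 : 0 ≤ τ * (4 * (2 * k ^ 2 * D) ^ 2 * δ ^ 2) := by positivity
    linarith

end Surplus

end ColouredHyperedges

/-! ### The expected surplus -/

namespace ColouredHyperedges

open scoped Classical

section Expectation

variable {V X 𝒮 Ω : Type*} [MeasurableSpace Ω] {β : 𝒮 → Type*} [∀ i, MeasurableSpace (β i)]
  [Fintype X] {G : ColouredHyperedges V X 𝒮} {μ : Measure Ω} {Z : ∀ i, Ω → β i}
  {R : Ω → Finset X} {m Δ : ℝ} {k : ℕ} {C c p D : ℝ}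

lemma integrable_comp_edgeSet [IsProbabilityMeasure μ] (h : G.IsLinearType μ Z R m Δ k C c p D)
    (g : Finset X → ℝ) : Integrable (fun ω => g (R ω)) μ := by
  let _ : MeasurableSpace (Finset X) := ⊤
  have hR : Measurable R := by
    refine measurable_to_countable' fun s => ?_
    have : R ⁻¹' {s} = ⋂ e, {ω | e ∈ R ω ↔ e ∈ s} := by
      ext ω
      simp [Finset.ext_iff]
    rw [this]
    refine MeasurableSet.iInter fun e => ?_
    by_cases he : e ∈ s
    · simpa [he] using measurableSet_mem h e
    · simp only [he, iff_false]
      exact (measurableSet_mem h e).compl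
  refine integrable_of_norm_le (C := ∑ s, ‖g s‖) (measurable_from_top.comp hR) fun ω => ?_
  exact Finset.single_le_sum (f := fun s => ‖g s‖) (fun s _ => norm_nonneg _)
    (Finset.mem_univ (R ω))

variable [Fintype V] [IsProbabilityMeasure μ] {Y : Finset X} {a b : X → V} {B : Finset V}

/-- The expected surplus is at least the expected surplus of the biased random `2`-cut with mean
signs `meanSign`, which is a sum over monomials. -/
lemma neg_sum_le_integral_surplus (h : G.IsLinearType μ Z R m Δ k C c p D) (a b : X → V)
    (Y : Finset X) (B : Finset V) (δ : ℝ) {τ : ℝ} (hτ0 : 0 ≤ τ) (hτ1 : τ ≤ 1) :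
    - ∑ e, ∑ T ∈ (G.verts e).powerset.erase ∅, Multihypergraph.cutCoeff (G.verts e) T *
        ∫ q, edgeInd R e q.1 * ∏ v ∈ T, meanSign (signedFluctuation μ R a δ) b Y B τ q v
          ∂μ.prod (signMeasure V)
      ≤ ∫ ω, (G.toMultihypergraph (R ω)).surplus ∂μ := by
  set z := meanSign (signedFluctuation μ R a δ) b Y B τ with hz
  have hzM : ∀ v, Measurable fun q => z q v := by
    intro v
    simp only [hz, meanSign]
    split_ifs
    · exact (Real.measurable_sin.comp (measurable_blockSum h a b δ Y v)).const_mul _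
    · exact (measurable_of_finite boolSign).comp ((measurable_pi_apply v).comp measurable_snd)
  have hz1 : ∀ q v, |z q v| ≤ 1 := abs_meanSign_le _ b Y B hτ0 hτ1
  have hint : ∀ e (T : Finset V), Integrable (fun q : Ω × (V → Bool) =>
      edgeInd R e q.1 * ∏ v ∈ T, z q v) (μ.prod (signMeasure V)) := by
    intro e T
    refine integrable_of_norm_le (C := 1) (((measurable_edgeInd h e).comp measurable_fst).mul
      (Finset.measurable_fun_prod T fun v _ => hzM v)) fun q => ?_
    rw [norm_mul, Real.norm_eq_abs, Real.norm_eq_abs, abs_of_nonneg (edgeInd_nonneg R e q.1),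
      Finset.abs_prod]
    exact mul_le_one₀ (edgeInd_le_one R e q.1) (Finset.prod_nonneg fun _ _ => abs_nonneg _)
      (Finset.prod_le_one (fun _ _ => abs_nonneg _) fun v _ => hz1 q v)
  have hsurp : ∫ q : Ω × (V → Bool), (G.toMultihypergraph (R q.1)).surplus
        ∂μ.prod (signMeasure V) = ∫ ω, (G.toMultihypergraph (R ω)).surplus ∂μ := by
    rw [integral_fun_fst fun ω => (G.toMultihypergraph (R ω)).surplus]
    simp
  have hpoly : ∫ q : Ω × (V → Bool), (- ∑ e, ∑ T ∈ (G.verts e).powerset.erase ∅,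
        Multihypergraph.cutCoeff (G.verts e) T * (edgeInd R e q.1 * ∏ v ∈ T, z q v))
          ∂μ.prod (signMeasure V)
      = - ∑ e, ∑ T ∈ (G.verts e).powerset.erase ∅, Multihypergraph.cutCoeff (G.verts e) T *
        ∫ q, edgeInd R e q.1 * ∏ v ∈ T, z q v ∂μ.prod (signMeasure V) := by
    rw [integral_neg, integral_finsetSum _ fun e _ =>
      integrable_finsetSum _ fun T _ => (hint e T).const_mul _]
    congr 1
    refine Finset.sum_congr rfl fun e _ => ?_
    rw [integral_finsetSum _ fun T _ => (hint e T).const_mul _]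
    exact Finset.sum_congr rfl fun T _ => integral_const_mul _ _
  rw [← hpoly, ← hsurp]
  refine integral_mono ?_ ?_ fun q => ?_
  · exact (integrable_finsetSum _ fun e _ =>
      integrable_finsetSum _ fun T _ => (hint e T).const_mul _).neg
  · exact (integrable_comp_edgeSet h fun s => (G.toMultihypergraph s).surplus).comp_fst _
  · refine le_trans (le_of_eq ?_) (Multihypergraph.surplus_ge G.verts (R q.1) (hz1 q))
    simp only [neg_inj]
    rw [← Finset.sum_subset (Finset.subset_univ (R q.1))]
    · refine Finset.sum_congr rfl fun e he => Finset.sum_congr rfl fun T _ => ?_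
      rw [edgeInd, if_pos he, one_mul]
    · intro e _ he
      refine Finset.sum_eq_zero fun T _ => ?_
      rw [edgeInd, if_neg he, zero_mul, mul_zero]

lemma sum_cutCoeff_mul_integral_le (h : G.IsLinearType μ Z R m Δ k C c p D) (hD : 0 ≤ D)
    (hΔ : 0 ≤ Δ) (hO : G.IsOriented Y a b B) (hp : 0 < p)
    (hY : ∀ e ∈ Y, p ≤ μ.real {ω | e ∈ R ω} ∧ μ.real {ω | e ∈ R ω} ≤ 1 - p) {δ τ : ℝ}
    (hδ : 0 ≤ δ) (hvar : Δ * (2 * k ^ 2 * D) * δ ^ 2 ≤ 1) (hτ0 : 0 ≤ τ) (hτ1 : τ ≤ 1) (e : X) :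
    ∑ T ∈ (G.verts e).powerset.erase ∅, Multihypergraph.cutCoeff (G.verts e) T *
        ∫ q, edgeInd R e q.1 * ∏ v ∈ T, meanSign (signedFluctuation μ R a δ) b Y B τ q v
          ∂μ.prod (signMeasure V)
      ≤ 2 * (τ * (4 * (2 * k ^ 2 * D) ^ 2 * δ ^ 2)
          + τ ^ 2 * (2 * k ^ 2 * D * δ + 4 * (2 * k ^ 2 * D) ^ 2 * δ ^ 2
            + (4 * (k * Δ) * (2 * k ^ 2 * D) ^ 2 * δ ^ 3
              + δ ^ 2 * (correlatedPairs G Y a b e).card / 2)))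
        - if e ∈ Y then τ * δ * p ^ 2 / 2 ^ k else 0 := by
  set L := τ * (4 * (2 * k ^ 2 * D) ^ 2 * δ ^ 2)
          + τ ^ 2 * (2 * k ^ 2 * D * δ + 4 * (2 * k ^ 2 * D) ^ 2 * δ ^ 2
            + (4 * (k * Δ) * (2 * k ^ 2 * D) ^ 2 * δ ^ 3
              + δ ^ 2 * (correlatedPairs G Y a b e).card / 2)) with hL
  have hL0 : 0 ≤ L := by positivity
  set A := τ * (δ * (μ.real {ω | e ∈ R ω} - μ.real {ω | e ∈ R ω} ^ 2) / 2) with hA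
  have h1 : ∀ T ∈ (G.verts e).powerset.erase ∅, Multihypergraph.cutCoeff (G.verts e) T *
        ∫ q, edgeInd R e q.1 * ∏ v ∈ T, meanSign (signedFluctuation μ R a δ) b Y B τ q v
          ∂μ.prod (signMeasure V)
      ≤ Multihypergraph.cutCoeff (G.verts e) T * L
        - if e ∈ Y ∧ T = {a e, b e} then Multihypergraph.cutCoeff (G.verts e) T * A else 0 := by
    intro T hT
    obtain ⟨hT0, hTe⟩ := Finset.mem_erase.1 hT
    refine (cutCoeff_mul_integral_le h hD hΔ hO hδ hvar hτ0 hτ1 e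
      (Finset.nonempty_iff_ne_empty.2 hT0) (Finset.mem_powerset.1 hTe)).trans (le_of_eq ?_)
    rw [mul_sub, mul_ite, mul_zero]
  refine (Finset.sum_le_sum h1).trans ?_
  rw [Finset.sum_sub_distrib, ← Finset.sum_mul]
  refine sub_le_sub (mul_le_mul_of_nonneg_right ?_ hL0) ?_
  · refine (Finset.sum_le_sum_of_subset_of_nonneg (Finset.erase_subset _ _) fun T _ _ =>
      Multihypergraph.cutCoeff_nonneg _ _).trans (Multihypergraph.sum_cutCoeff_le _)
  · split_ifs with he
    · have hab : a e ≠ b e := fun hab => hO.tail_notMem e he (hab ▸ hO.head_mem_part e he)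
      have hmem : ({a e, b e} : Finset V) ∈ (G.verts e).powerset.erase ∅ := by
        refine Finset.mem_erase.2 ⟨Finset.insert_ne_empty _ _, Finset.mem_powerset.2 ?_⟩
        intro v hv
        rcases Finset.mem_insert.1 hv with rfl | hv
        · exact hO.tail_mem e he
        · rw [Finset.mem_singleton.1 hv]
          exact hO.head_mem e he
      simp only [he, true_and]
      rw [Finset.sum_ite_eq' ((G.verts e).powerset.erase ∅) ({a e, b e} : Finset V), if_pos hmem,
        Multihypergraph.cutCoeff_of_even _ (by rw [Finset.card_pair hab]; exact even_two)]
      obtain ⟨hp1, hp2⟩ := hY e he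
      have hAp : τ * (δ * p ^ 2 / 2) ≤ A := by
        rw [hA]
        have : p ^ 2 ≤ μ.real {ω | e ∈ R ω} - μ.real {ω | e ∈ R ω} ^ 2 := by nlinarith
        gcongr
      have hpow : (2 : ℝ) / 2 ^ k ≤ 2 / 2 ^ (G.verts e).card := by
        have := h.card_verts_le e
        gcongr
        norm_num
      calc τ * δ * p ^ 2 / 2 ^ k = 2 / 2 ^ k * (τ * (δ * p ^ 2 / 2)) := by ring
        _ ≤ 2 / 2 ^ (G.verts e).card * A := by gcongr
    · refine Finset.sum_nonneg fun T _ => ?_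
      rw [if_neg fun h => he h.1]

/-- The bound obtained from the biased random `2`-cut in terms of the two parameters `θ` (the
scale of the block sums) and `τ` (the strength of the bias). -/
lemma integral_surplus_ge (h : G.IsLinearType μ Z R m Δ k C c p D) (hC : 0 ≤ C) (hD : 0 ≤ D)
    (hm : 0 ≤ m) (hΔ : 1 ≤ Δ) (hO : G.IsOriented Y a b B) (hp : 0 < p)
    (hY : ∀ e ∈ Y, p ≤ μ.real {ω | e ∈ R ω} ∧ μ.real {ω | e ∈ R ω} ≤ 1 - p)
    (hYcard : c * m ≤ 2 * Y.card) {θ τ : ℝ}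
    (hθ0 : 0 ≤ θ) (hθ1 : θ ≤ 1) (hθ : 2 * k ^ 2 * D * θ ≤ 1) (hτ0 : 0 ≤ τ) (hτ1 : τ ≤ 1) :
    m / Real.sqrt Δ * (τ * θ * (c * p ^ 2 / 2 ^ (k + 1))
        - τ * θ ^ 2 * (8 * C * (2 * k ^ 2 * D) ^ 2)
        - τ ^ 2 * (C * (2 * (2 * k ^ 2 * D) + 8 * (2 * k ^ 2 * D) ^ 2
          + 8 * k * (2 * k ^ 2 * D) ^ 2 + k * D ^ 2)))
      ≤ ∫ ω, (G.toMultihypergraph (R ω)).surplus ∂μ := by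
  set s := Real.sqrt Δ with hs
  have hs1 : 1 ≤ s := by rw [hs]; exact Real.one_le_sqrt.2 hΔ
  have hs0 : 0 < s := by linarith
  have hsΔ : Δ = s ^ 2 := (Real.sq_sqrt (by linarith)).symm
  set M : ℝ := 2 * k ^ 2 * D with hM
  have hM0 : 0 ≤ M := by positivity
  set δ := θ / s with hδ
  have hδ0 : 0 ≤ δ := by positivity
  have hvar : Δ * M * δ ^ 2 ≤ 1 := by
    have : Δ * M * δ ^ 2 = M * θ * θ := by
      rw [hsΔ, hδ]; field_simp
    rw [this]
    exact mul_le_one₀ hθ hθ0 hθ1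
  refine le_trans ?_ (neg_sum_le_integral_surplus h a b Y B δ hτ0 hτ1)
  have hsum := Finset.sum_le_sum fun e (_ : e ∈ Finset.univ) =>
    sum_cutCoeff_mul_integral_le h hD (zero_le_one.trans hΔ) hO hp hY hδ0 hvar hτ0 hτ1 e
  simp only [Finset.sum_sub_distrib, Finset.sum_add_distrib, ← Finset.mul_sum, ← Finset.sum_div,
    Finset.sum_const, Finset.card_univ, nsmul_eq_mul, Finset.sum_ite_mem,
    Finset.univ_inter] at hsum
  have hN := sum_card_correlatedPairs_le h hD hO
  set N : ℝ := ∑ e, ((correlatedPairs G Y a b e).card : ℝ) with hNdef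
  set n : ℝ := (Fintype.card X : ℝ) with hn
  have hn0 : 0 ≤ n := Nat.cast_nonneg _
  have hnC : n ≤ C * m := h.card_le
  refine le_trans ?_ (neg_le_neg hsum)
  have hs_inv : 0 ≤ 1 / s := by positivity
  -- powers of `1 / s` and of `θ` beyond the first only help
  have hδ1 : δ ≤ 1 / s := by rw [hδ]; gcongr
  have hδ2 : δ ^ 2 ≤ θ ^ 2 * (1 / s) := by
    rw [hδ, div_pow, div_eq_mul_one_div]
    gcongr
    exact le_self_pow₀ hs1 two_ne_zero
  have hδ2' : δ ^ 2 ≤ 1 / s :=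
    hδ2.trans (mul_le_of_le_one_left hs_inv (pow_le_one₀ hθ0 hθ1))
  have hδ3 : Δ * δ ^ 3 ≤ 1 / s := by
    have : Δ * δ ^ 3 = θ ^ 3 * (1 / s) := by rw [hsΔ, hδ]; field_simp
    rw [this]
    exact mul_le_of_le_one_left hs_inv (pow_le_one₀ hθ0 hθ1)
  have hgain : m / s * (τ * θ * (c * p ^ 2 / 2 ^ (k + 1)))
      ≤ Y.card * (τ * δ * p ^ 2 / 2 ^ k) := by
    have h1 : m / s * (τ * θ * (c * p ^ 2 / 2 ^ (k + 1)))
        = (c * m) / 2 * (τ * δ * p ^ 2 / 2 ^ k) := by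
      rw [hδ]; field_simp; ring
    rw [h1]
    have : c * m / 2 ≤ Y.card := by linarith
    gcongr
  have hloss1 : n * (τ * (4 * M ^ 2 * δ ^ 2)) ≤ C * m * (τ * (4 * M ^ 2 * (θ ^ 2 * (1 / s)))) := by
    gcongr
  have hloss2 : n * (M * δ + 4 * M ^ 2 * δ ^ 2)
      ≤ C * m * (M * (1 / s) + 4 * M ^ 2 * (1 / s)) := by
    gcongr
  have hloss3 : n * (4 * (k * Δ) * M ^ 2 * δ ^ 3) ≤ C * m * (4 * k * M ^ 2 * (1 / s)) := by
    have : 4 * (k * Δ) * M ^ 2 * δ ^ 3 = 4 * k * M ^ 2 * (Δ * δ ^ 3) := by ring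
    rw [this]
    exact mul_le_mul hnC (mul_le_mul_of_nonneg_left hδ3 (by positivity)) (by positivity)
      (hn0.trans hnC)
  have hloss4 : δ ^ 2 * N / 2 ≤ (1 / s) * (C * m * (k * D ^ 2)) / 2 := by
    have : N ≤ C * m * (k * D ^ 2) := hN.trans (by gcongr)
    have hN0 : 0 ≤ N := Finset.sum_nonneg fun _ _ => Nat.cast_nonneg _
    exact div_le_div_of_nonneg_right (mul_le_mul hδ2' this hN0 hs_inv) zero_le_two
  have hτ2 : 0 ≤ τ ^ 2 := sq_nonneg τ
  have hcomb := mul_le_mul_of_nonneg_left (add_le_add hloss2 (add_le_add hloss3 hloss4)) hτ2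
  have hid : m / s * (τ * θ * (c * p ^ 2 / 2 ^ (k + 1)) - τ * θ ^ 2 * (8 * C * M ^ 2)
        - τ ^ 2 * (C * (2 * M + 8 * M ^ 2 + 8 * k * M ^ 2 + k * D ^ 2)))
      = m / s * (τ * θ * (c * p ^ 2 / 2 ^ (k + 1)))
        - 2 * (C * m * (τ * (4 * M ^ 2 * (θ ^ 2 * (1 / s)))))
        - 2 * (τ ^ 2 * (C * m * (M * (1 / s) + 4 * M ^ 2 * (1 / s))
          + (C * m * (4 * k * M ^ 2 * (1 / s)) + (1 / s) * (C * m * (k * D ^ 2)) / 2))) := by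
    ring
  rw [← hM] at hsum
  have hrhs : 2 * (τ * (4 * M ^ 2 * (n * δ ^ 2)) + τ ^ 2 * (M * (n * δ)
        + 4 * M ^ 2 * (n * δ ^ 2) + (4 * (k * Δ) * M ^ 2 * (n * δ ^ 3) + δ ^ 2 * N / 2)))
        - τ * δ * (Y.card * p ^ 2) / 2 ^ k
      = 2 * (n * (τ * (4 * M ^ 2 * δ ^ 2))) + 2 * (τ ^ 2 * (n * (M * δ + 4 * M ^ 2 * δ ^ 2)
        + (n * (4 * (k * Δ) * M ^ 2 * δ ^ 3) + δ ^ 2 * N / 2)))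
        - Y.card * (τ * δ * p ^ 2 / 2 ^ k) := by
    ring
  rw [hid, hrhs]
  linarith

end Expectation

end ColouredHyperedges

theorem mainTheorem6 (k : ℕ) (C c p D : ℝ) (hc : 0 < c) (hp : 0 < p) :
    ∃ c' : ℝ, 0 < c' ∧
      ∀ (m Δ : ℝ), 1 ≤ m → 1 ≤ Δ →
      ∀ (V X 𝒮 Ω : Type*) [Fintype V] [Fintype X] [MeasurableSpace Ω]
        (β : 𝒮 → Type*) [∀ i, MeasurableSpace (β i)]
        (μ : MeasureTheory.Measure Ω) [MeasureTheory.IsProbabilityMeasure μ]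
        (G : ColouredHyperedges V X 𝒮) (Z : ∀ i, Ω → β i) (R : Ω → Finset X),
        G.IsLinearType μ Z R m Δ k C c p D →
        c' * (m / Real.sqrt Δ) ≤ ∫ ω, (G.toMultihypergraph (R ω)).surplus ∂μ := by
  set C₀ := max C 0 with hC₀
  set D₀ := max D 0 with hD₀
  have hC : 0 ≤ C₀ := le_max_right _ _
  have hD : 0 ≤ D₀ := le_max_right _ _
  set M : ℝ := 2 * k ^ 2 * D₀ with hM
  have hM0 : 0 ≤ M := by positivity
  set g : ℝ := c * p ^ 2 / 2 ^ (k + 1) with hg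
  have hg0 : 0 < g := by positivity
  set K : ℝ := C₀ * (2 * M + 8 * M ^ 2 + 8 * k * M ^ 2 + k * D₀ ^ 2) with hK
  have hK0 : 0 ≤ K := by positivity
  -- with these choices each of the two loss terms is at most a quarter of the gain
  set θ : ℝ := min (1 / (M + 1)) (g / (32 * C₀ * M ^ 2 + 1)) with hθ
  have hθ0 : 0 < θ := lt_min (by positivity) (by positivity)
  have hθM : (M + 1) * θ ≤ 1 := by
    have := min_le_left (1 / (M + 1)) (g / (32 * C₀ * M ^ 2 + 1))
    rw [← hθ, le_div_iff₀ (by positivity)] at this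
    linarith
  have hθg : θ * (8 * C₀ * M ^ 2) ≤ g / 4 := by
    have := min_le_right (1 / (M + 1)) (g / (32 * C₀ * M ^ 2 + 1))
    rw [← hθ, le_div_iff₀ (by positivity)] at this
    linarith
  have hMθ0 : 0 ≤ M * θ := by positivity
  set τ : ℝ := min 1 (θ * g / (4 * K + 1)) with hτ
  have hτ0 : 0 < τ := lt_min one_pos (by positivity)
  have hτ1 : τ ≤ 1 := min_le_left _ _
  have hτK : τ * K ≤ θ * g / 4 := by
    have := min_le_right 1 (θ * g / (4 * K + 1))
    rw [← hτ, le_div_iff₀ (by positivity)] at this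
    linarith
  refine ⟨τ * θ * g / 2, by positivity, ?_⟩
  intro m Δ hm hΔ V X 𝒮 Ω _ _ _ β _ μ _ G Z R h₀
  have h := h₀.mono (by linarith) (le_max_left C 0) (le_max_left D 0)
  rw [← hC₀, ← hD₀] at h
  obtain ⟨Y, hYcard, hY⟩ := h.gain
  have hYne : Y.Nonempty := by
    rw [← Finset.card_pos]
    have : 0 < c * m := by positivity
    exact_mod_cast this.trans_le hYcard
  obtain ⟨e, he⟩ := hYne
  obtain ⟨v, -⟩ := Finset.card_pos.1 (zero_lt_two.trans_le (hY e he).1)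
  have : Nonempty V := ⟨v⟩
  obtain ⟨Y', a, b, B, hY'Y, hcard, hO⟩ := G.exists_isOriented Y fun e he => (hY e he).1
  have hcard' : (Y.card : ℝ) ≤ 2 * Y'.card := by exact_mod_cast hcard
  refine le_trans ?_ (ColouredHyperedges.integral_surplus_ge h hC hD (zero_le_one.trans hm) hΔ hO
    hp (fun e he => (hY e (hY'Y he)).2) (hYcard.trans hcard') hθ0.le (by linarith) (by linarith)
    hτ0.le hτ1)
  rw [← hM, ← hg, ← hK, mul_comm]
  refine mul_le_mul_of_nonneg_left ?_ (by positivity)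
  have h1 : τ * θ ^ 2 * (8 * C₀ * M ^ 2) ≤ τ * θ * (g / 4) := by
    calc τ * θ ^ 2 * (8 * C₀ * M ^ 2) = τ * θ * (θ * (8 * C₀ * M ^ 2)) := by ring
      _ ≤ τ * θ * (g / 4) := by gcongr
  have h2 : τ ^ 2 * K ≤ τ * (θ * g / 4) := by
    calc τ ^ 2 * K = τ * (τ * K) := by ring
      _ ≤ τ * (θ * g / 4) := by gcongr
  linarith
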